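/- Let $n\ge 0$, let $l=\mathcal O(1)$ be the hyperplane bundle on $\mathbb{CP}^{2n+1}$ and $\mathbb T$ its holomorphic tangent bundle. Let $\gamma=z^0dz^1-z^1dz^0+\cdots+z^{2n}dz^{2n+1}-z^{2n+1}dz^{2n}$ (in homogeneous coordinates) be the standard contact structure, regarded as a holomorphic section of $l^2\otimes\mathbb T^*$, and let $D=\ker\gamma\subset\mathbb T$. For integers $m$ and $1\le k\le 2n+1$ extend $\gamma$ to $l^m\otimes\bigwedge^k\mathbb T\to l^{m+2}\otimes\bigwedge^{k-1}D$ by $$v_1\wedge\cdots\wedge v_k\mapsto\sum_{j=1}^k(-1)^{j-1}\gamma(v_j)\otimes v_1\wedge\cdots\wedge v_{j-1}\wedge v_{j+1}\wedge\cdots\wedge v_k .$$ Write $\mathcal O(E)$ for the sheaf of holomorphic sections of a holomorphic vector bundle $E$, $H^i(E)$ for the sheaf cohomology group $H^i(\mathbb{CP}^{2n+1},\mathcal O(E))$, and $[x]$ for the integer part of $x$. Suppose that $k$ and $m$ satisfy one of the following conditions: 1. $m$ is even and $m\le -2n-2[\frac k2]-4$; 2. $m$ is even, $1\le k\le n$ and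 $-2n-2\le m\le -2k-2$; 3. $m$ is even and $m\ge -2[\frac k2]$; 4. $m$ is odd and $m\le -2n-2[\frac k2]-3$; 5. $m$ is odd and $m\ge -2n-3$. Then the sequence $$0\to\mathcal O(l^m\otimes\textstyle\bigwedge^kD)\to\mathcal O(l^m\otimes\bigwedge^k\mathbb T)\stackrel{\gamma}{\to}\mathcal O(l^{m+2}\otimes\bigwedge^{k-1}D)\to0$$ is a split short exact sequence of sheaves of $\mathbb C$-modules, and for each $i=0,\dots,2n+1$ the induced sequence $$0\to H^i(l^m\otimes\textstyle\bigwedge^kD)\to H^i(l^m\otimes\bigwedge^k\mathbb T)\to H^i(l^{m+2}\otimes\bigwedge^{k-1}D)\to0$$ is exact. -/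

import Mathlib

open scoped Manifold ContDiff LinearAlgebra.Projectivization
open CategoryTheory TopologicalSpace Opposite

namespace ContactCP

noncomputable section

/-- The space `ℂ^(N+1)` of homogeneous coordinate vectors. -/
abbrev Vec (N : ℕ) : Type := Fin (N + 1) → ℂ

/-- Complex projective space `ℂP^N`. -/
abbrev CP (N : ℕ) : Type := ℙ ℂ (Vec N)

/-- The quotient topology on `ℂP^N`. -/
instance (N : ℕ) : TopologicalSpace (CP N) :=
  inferInstanceAs (TopologicalSpace (Quotient (projectivizationSetoid ℂ (Vec N))))

/-- The quotient map from the nonzero vectors to `ℂP^N`. -/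
abbrev proj {N : ℕ} (z : {z : Vec N // z ≠ 0}) : CP N := Projectivization.mk' ℂ z

theorem isQuotientMap_proj {N : ℕ} : Topology.IsQuotientMap (proj (N := N)) :=
  isQuotientMap_quotient_mk'

/-- `x ↦ (x_j / x_i)_{j ≠ i}`, as a function on all of `ℂP^N` (only used where `x_i ≠ 0`). -/
def affineCoord {N : ℕ} (i : Fin (N + 1)) (x : CP N) : Fin N → ℂ :=
  fun j => x.rep (i.succAbove j) / x.rep i

theorem rep_mk {N : ℕ} (z : Vec N) (hz : z ≠ 0) :
    ∃ a : ℂ, a ≠ 0 ∧ (Projectivization.mk ℂ z hz).rep = a • z := by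
  obtain ⟨a, ha⟩ := Projectivization.exists_smul_eq_mk_rep ℂ z hz
  exact ⟨a, a.ne_zero, ha.symm⟩

theorem rep_mk_ne_zero {N : ℕ} (i : Fin (N + 1)) (z : Vec N) (hz : z ≠ 0) :
    (Projectivization.mk ℂ z hz).rep i ≠ 0 ↔ z i ≠ 0 := by
  obtain ⟨a, ha, h⟩ := rep_mk z hz
  rw [h]; simp [ha]

theorem affineCoord_mk {N : ℕ} (i : Fin (N + 1)) (z : Vec N) (hz : z ≠ 0) :
    affineCoord i (Projectivization.mk ℂ z hz) = fun j => z (i.succAbove j) / z i := by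
  obtain ⟨a, ha, h⟩ := rep_mk z hz
  funext j
  simp only [affineCoord, h, Pi.smul_apply, smul_eq_mul]
  exact mul_div_mul_left _ _ ha

/-- The homogeneous coordinate vector with `i`-th entry `1` and the other entries `w`. -/
def affineVec {N : ℕ} (i : Fin (N + 1)) (w : Fin N → ℂ) : Vec N := i.insertNth 1 w

theorem affineVec_same {N : ℕ} (i : Fin (N + 1)) (w : Fin N → ℂ) : affineVec i w i = 1 := by
  simp [affineVec]

theorem affineVec_succAbove {N : ℕ} (i : Fin (N + 1)) (w : Fin N → ℂ) (j : Fin N) :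
    affineVec i w (i.succAbove j) = w j := by
  simp [affineVec]

theorem affineVec_ne_zero {N : ℕ} (i : Fin (N + 1)) (w : Fin N → ℂ) : affineVec i w ≠ 0 :=
  fun h => one_ne_zero (α := ℂ) (by rw [← affineVec_same i w, h]; rfl)

theorem continuous_affineVec {N : ℕ} (i : Fin (N + 1)) :
    Continuous (affineVec (N := N) i) :=
  Continuous.finInsertNth i continuous_const continuous_id

theorem smul_affineVec {N : ℕ} (i : Fin (N + 1)) (z : Vec N) (h : z i ≠ 0) :
    z i • affineVec i (fun j => z (i.succAbove j) / z i) = z := by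
  funext a
  refine Fin.succAboveCases i ?_ (fun j => ?_) a
  · simp [affineVec_same]
  · simp only [Pi.smul_apply, affineVec_succAbove, smul_eq_mul]
    field_simp

theorem isOpen_affineSource {N : ℕ} (i : Fin (N + 1)) : IsOpen {x : CP N | x.rep i ≠ 0} := by
  rw [← isQuotientMap_proj.isOpen_preimage]
  have : proj ⁻¹' {x : CP N | x.rep i ≠ 0} = {z : {z : Vec N // z ≠ 0} | z.1 i ≠ 0} := by
    ext z; exact rep_mk_ne_zero i z.1 z.2
  rw [this]
  exact isOpen_ne_fun ((continuous_apply i).comp continuous_subtype_val) continuous_const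

/-- The standard affine chart of `ℂP^N` on `{x_i ≠ 0}`. -/
def affineChart {N : ℕ} (i : Fin (N + 1)) : OpenPartialHomeomorph (CP N) (Fin N → ℂ) where
  toFun := affineCoord i
  invFun w := Projectivization.mk ℂ (affineVec i w) (affineVec_ne_zero i w)
  source := {x | x.rep i ≠ 0}
  target := Set.univ
  map_source' _ _ := Set.mem_univ _
  map_target' w _ := (rep_mk_ne_zero i _ _).2 (by rw [affineVec_same]; exact one_ne_zero)
  left_inv' x hx := by
    induction x using Projectivization.ind with
    | h z hz =>
      have hz' : z i ≠ 0 := (rep_mk_ne_zero i z hz).1 hx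
      rw [Projectivization.mk_eq_mk_iff', affineCoord_mk]
      exact ⟨(z i)⁻¹, by rw [inv_smul_eq_iff₀ hz', smul_affineVec i z hz']⟩
  right_inv' w _ := by
    rw [affineCoord_mk]
    funext j
    rw [affineVec_same, affineVec_succAbove, div_one]
  open_source := isOpen_affineSource i
  open_target := isOpen_univ
  continuousOn_toFun := by
    rw [isQuotientMap_proj.continuousOn_isOpen_iff (isOpen_affineSource i)]
    have : Set.EqOn (affineCoord i ∘ proj) (fun z j => z.1 (i.succAbove j) / z.1 i)
        (proj ⁻¹' {x : CP N | x.rep i ≠ 0}) := fun z _ => affineCoord_mk i z.1 z.2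
    refine ContinuousOn.congr ?_ this
    refine continuousOn_pi.2 fun j => ContinuousOn.div ?_ ?_ ?_
    · exact ((continuous_apply _).comp continuous_subtype_val).continuousOn
    · exact ((continuous_apply _).comp continuous_subtype_val).continuousOn
    · exact fun z hz => (rep_mk_ne_zero i z.1 z.2).1 hz
  continuousOn_invFun := by
    refine Continuous.continuousOn ?_
    exact isQuotientMap_proj.continuous.comp
      ((continuous_affineVec i).subtype_mk (affineVec_ne_zero i))

theorem exists_rep_ne_zero {N : ℕ} (x : CP N) : ∃ i, x.rep i ≠ 0 := by
  by_contra! h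
  exact x.rep_nonzero (funext h)

/-- The index of the affine chart chosen around `x`. -/
def idx {N : ℕ} (x : CP N) : Fin (N + 1) := (exists_rep_ne_zero x).choose

theorem rep_idx_ne_zero {N : ℕ} (x : CP N) : x.rep (idx x) ≠ 0 := (exists_rep_ne_zero x).choose_spec

/-- The standard atlas of `ℂP^N`. -/
instance (N : ℕ) : ChartedSpace (Fin N → ℂ) (CP N) where
  atlas := Set.range affineChart
  chartAt x := affineChart (idx x)
  mem_chart_source x := rep_idx_ne_zero x
  chart_mem_atlas _ := Set.mem_range_self _

/-- `ℂP^N` is a complex manifold. -/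
instance (N : ℕ) : IsManifold 𝓘(ℂ, Fin N → ℂ) ω (CP N) := by
  refine isManifold_of_contDiffOn _ _ _ ?_
  rintro _ _ ⟨i, rfl⟩ ⟨j, rfl⟩
  have hlin : ∀ a : Fin (N + 1), ContDiff ℂ ω fun w : Fin N → ℂ => affineVec i w a := by
    intro a
    refine Fin.succAboveCases i ?_ (fun b => ?_) a
    · simp only [affineVec_same]; exact contDiff_const
    · simp only [affineVec_succAbove]; exact contDiff_apply ℂ ℂ b
  have hsrc : ∀ w ∈ 𝓘(ℂ, Fin N → ℂ).symm ⁻¹' ((affineChart i).symm ≫ₕ affineChart j).source ∩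
      Set.range 𝓘(ℂ, Fin N → ℂ), affineVec i w j ≠ 0 := by
    intro w hw
    have : w ∈ ((affineChart i).symm ≫ₕ affineChart j).source := hw.1
    rw [OpenPartialHomeomorph.trans_source] at this
    exact (rep_mk_ne_zero j _ (affineVec_ne_zero i w)).1 this.2
  refine ContDiffOn.congr (f := fun w a => affineVec i w (j.succAbove a) / affineVec i w j) ?_ ?_
  · exact contDiffOn_pi.2 fun a => (hlin _).contDiffOn.div (hlin _).contDiffOn hsrc
  · intro w _
    exact affineCoord_mk j _ (affineVec_ne_zero i w)

/-- The punctured line of vectors representing `x`. -/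
abbrev Line {N : ℕ} (x : CP N) : Type :=
  {z : Vec N // ∃ h : z ≠ 0, Projectivization.mk ℂ z h = x}

/-- The holomorphic tangent space of `ℂP^N` at `x`. -/
abbrev T {N : ℕ} (x : CP N) : Type := TangentSpace 𝓘(ℂ, Fin N → ℂ) x

/-- The exterior algebra of the tangent space at `x`. -/
abbrev ExtT {N : ℕ} (x : CP N) : Type := ExteriorAlgebra ℂ (T x)

/-- For a subspace `F` of the exterior algebra of `T_x`, the space `l_x^m ⊗ F`, where `l = O(1)`.
The fibre `l_x` is the dual of the tautological line `x ∪ {0}`, so an element of `l_x^m ⊗ F` is a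
function on the punctured line with values in `F` that is homogeneous of degree `m`. -/
def Fiber {N : ℕ} (m : ℤ) {x : CP N} (F : Submodule ℂ (ExtT x)) :
    Submodule ℂ (Line x → ExtT x) where
  carrier := {f | (∀ z, f z ∈ F) ∧ ∀ (z z' : Line x) (a : ℂ), z'.1 = a • z.1 → f z' = a ^ m • f z}
  add_mem' {f g} hf hg := ⟨fun z => F.add_mem (hf.1 z) (hg.1 z), fun z z' a h => by
    simp only [Pi.add_apply, hf.2 z z' a h, hg.2 z z' a h, smul_add]⟩
  zero_mem' := ⟨fun _ => F.zero_mem, fun _ _ _ _ => by simp⟩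
  smul_mem' c f hf := ⟨fun z => F.smul_mem c (hf.1 z), fun z z' a h => by
    simp only [Pi.smul_apply, hf.2 z z' a h]
    rw [smul_comm]⟩

/-- The preimage of a subset of `ℂP^N` in the space of nonzero vectors. -/
def cone {N : ℕ} (S : Set (CP N)) : Set (Vec N) :=
  {z | ∃ h : z ≠ 0, Projectivization.mk ℂ z h ∈ S}

theorem isOpen_cone {N : ℕ} {S : Set (CP N)} (hS : IsOpen S) : IsOpen (cone S) := by
  have h1 : IsOpen (proj ⁻¹' S) := hS.preimage isQuotientMap_proj.continuous
  have h2 : IsOpen {z : Vec N | z ≠ 0} := isOpen_ne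
  have : cone S = Subtype.val '' (proj ⁻¹' S) := by
    ext z
    constructor
    · rintro ⟨h, hz⟩; exact ⟨⟨z, h⟩, hz, rfl⟩
    · rintro ⟨⟨w, h⟩, hz, rfl⟩; exact ⟨h, hz⟩
  rw [this]
  exact h2.isOpenMap_subtype_val _ h1

/-- The coordinates of tangent vectors at `x` in the trivialization of the tangent bundle given by
the chart around `x₀`. -/
abbrev triv {N : ℕ} (x₀ x : CP N) : T x →ₗ[ℂ] (Fin N → ℂ) :=
  ((trivializationAt (Fin N → ℂ) (TangentSpace 𝓘(ℂ, Fin N → ℂ)) x₀).continuousLinearMapAt ℂ x :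
    T x →L[ℂ] (Fin N → ℂ)).toLinearMap

open Classical in
/-- A family of functions on the punctured lines over `U`, written as one function on the cone over
`U` in the trivialization of the exterior algebra bundle given by the chart around `x₀`
(and extended by `0` outside the cone over `U`). -/
def localRep {N : ℕ} {U : Opens (CP N)} (σ : ∀ x : U, Line x.1 → ExtT x.1) (x₀ : CP N) (z : Vec N) :
    ExteriorAlgebra ℂ (Fin N → ℂ) :=
  if h : z ∈ cone (U : Set (CP N)) then
    ExteriorAlgebra.map (triv x₀ (Projectivization.mk ℂ z h.1))
      (σ ⟨Projectivization.mk ℂ z h.1, h.2⟩ ⟨z, h.1, rfl⟩)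
  else 0

/-- Holomorphy of a section: all its components in the local trivializations are holomorphic
functions of the homogeneous coordinates. -/
def IsHolomorphic {N : ℕ} {U : Opens (CP N)} (σ : ∀ x : U, Line x.1 → ExtT x.1) : Prop :=
  ∀ (x₀ : CP N) (φ : Module.Dual ℂ (ExteriorAlgebra ℂ (Fin N → ℂ))),
    DifferentiableOn ℂ (fun z => φ (localRep σ x₀ z))
      (cone ((U : Set (CP N)) ∩ (chartAt (Fin N → ℂ) x₀).source))

/-- The space of holomorphic sections over `U` of `l^m ⊗ F`. -/
def sections {N : ℕ} (m : ℤ) (F : ∀ x : CP N, Submodule ℂ (ExtT x)) (U : Opens (CP N)) :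
    Submodule ℂ (∀ x : U, Fiber m (F x.1)) where
  carrier := {σ | IsHolomorphic fun x => (σ x).1}
  add_mem' {σ τ} hσ hτ x₀ φ := by
    refine ((hσ x₀ φ).add (hτ x₀ φ)).congr fun z hz => ?_
    have h : z ∈ cone (U : Set (CP N)) := ⟨hz.1, hz.2.1⟩
    simp [localRep, h]
  zero_mem' x₀ φ := by
    refine (differentiableOn_const 0).congr fun z hz => ?_
    have h : z ∈ cone (U : Set (CP N)) := ⟨hz.1, hz.2.1⟩
    simp [localRep, h]
  smul_mem' c σ hσ x₀ φ := by
    refine ((hσ x₀ φ).const_smul c).congr fun z hz => ?_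
    have h : z ∈ cone (U : Set (CP N)) := ⟨hz.1, hz.2.1⟩
    simp [localRep, h]

theorem localRep_restrict {N : ℕ} {U V : Opens (CP N)} (i : V ≤ U)
    (σ : ∀ x : U, Line x.1 → ExtT x.1) (x₀ : CP N) (z : Vec N) (hz : z ∈ cone (V : Set (CP N))) :
    localRep (fun x : V => σ ⟨x.1, i x.2⟩) x₀ z = localRep σ x₀ z := by
  have hz' : z ∈ cone (U : Set (CP N)) := ⟨hz.1, i hz.2⟩
  simp [localRep, hz, hz']

/-- Holomorphy is a local condition. -/
def holomorphicLocal {N : ℕ} (m : ℤ) (F : ∀ x : CP N, Submodule ℂ (ExtT x)) :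
    TopCat.LocalPredicate (X := TopCat.of (CP N)) (fun x : CP N => Fiber m (F x)) where
  pred {U} σ := σ ∈ sections m F U
  res {U V} i σ h x₀ φ := by
    refine ((h x₀ φ).mono fun z hz => ⟨hz.1, i.le hz.2.1, hz.2.2⟩).congr fun z hz => ?_
    exact congrArg φ (localRep_restrict i.le (fun x => (σ x).1) x₀ z ⟨hz.1, hz.2.1⟩)
  locality {U} σ h x₀ φ := by
    rintro z ⟨hz, hzU, hzs⟩
    obtain ⟨V, hV, i, hσ⟩ := h ⟨Projectivization.mk ℂ z hz, hzU⟩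
    have ho : IsOpen (cone ((V : Set (CP N)) ∩ (chartAt (Fin N → ℂ) x₀).source)) :=
      isOpen_cone (V.2.inter (chartAt (Fin N → ℂ) x₀).open_source)
    have hd := (hσ x₀ φ).differentiableAt (ho.mem_nhds ⟨hz, hV, hzs⟩)
    refine (hd.congr_of_eventuallyEq ?_).differentiableWithinAt
    filter_upwards [ho.mem_nhds ⟨hz, hV, hzs⟩] with w hw
    exact (congrArg φ (localRep_restrict i.le (fun x => (σ x).1) x₀ w ⟨hw.1, hw.2.1⟩)).symm

/-- The presheaf of holomorphic sections of `l^m ⊗ F`, with values in complex vector spaces. -/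
def sectionsPresheaf {N : ℕ} (m : ℤ) (F : ∀ x : CP N, Submodule ℂ (ExtT x)) :
    TopCat.Presheaf (ModuleCat.{0} ℂ) (TopCat.of (CP N)) where
  obj U := ModuleCat.of ℂ (sections m F U.unop)
  map {U V} i := ModuleCat.ofHom
    { toFun := fun σ => ⟨fun x => σ.1 ⟨x.1, i.unop.le x.2⟩,
        (holomorphicLocal m F).res i.unop σ.1 σ.2⟩
      map_add' := fun _ _ => rfl
      map_smul' := fun _ _ => rfl }

/-- The sheaf `O(l^m ⊗ F)` of complex vector spaces on `ℂP^N`. -/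
def sectionsSheaf {N : ℕ} (m : ℤ) (F : ∀ x : CP N, Submodule ℂ (ExtT x)) :
    TopCat.Sheaf (ModuleCat.{0} ℂ) (TopCat.of (CP N)) :=
  ⟨sectionsPresheaf m F, (TopCat.Presheaf.isSheaf_iff_isSheaf_comp (forget (ModuleCat.{0} ℂ)) _).2
    (TopCat.Presheaf.isSheaf_of_iso
      (NatIso.ofComponents (fun _ => Iso.refl _) :
        (TopCat.subsheafToTypes (holomorphicLocal m F)).1 ≅ sectionsPresheaf m F ⋙ forget _)
      (TopCat.subsheafToTypes (holomorphicLocal m F)).2)⟩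

/-! ### Contraction -/

open CliffordAlgebra (contractLeft contractLeft_ι_mul)

theorem ext_induction {V : Type*} [AddCommGroup V] [Module ℂ V] {P : ExteriorAlgebra ℂ V → Prop}
    (hs : ∀ r : ℂ, P (algebraMap ℂ _ r)) (ha : ∀ X Y, P X → P Y → P (X + Y))
    (hm : ∀ (v : V) (X), P X → P (ExteriorAlgebra.ι ℂ v * X)) (X : ExteriorAlgebra ℂ V) : P X :=
  CliffordAlgebra.left_induction (Q := (0 : QuadraticForm ℂ V)) hs ha (fun X v h => hm v X h) X

/-- The contraction
`v_1 ∧ ⋯ ∧ v_k ↦ ∑ (-1)^(j-1) θ(v_j) v_1 ∧ ⋯ ∧ v_(j-1) ∧ v_(j+1) ∧ ⋯ ∧ v_k` by a linear form. -/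
def contract {V : Type*} [AddCommGroup V] [Module ℂ V] (θ : V →ₗ[ℂ] ℂ) :
    ExteriorAlgebra ℂ V →ₗ[ℂ] ExteriorAlgebra ℂ V :=
  contractLeft (Q := (0 : QuadraticForm ℂ V)) θ

section contract

variable {V W : Type*} [AddCommGroup V] [Module ℂ V] [AddCommGroup W] [Module ℂ W]
variable (θ : V →ₗ[ℂ] ℂ)

theorem contract_ι_mul (v : V) (X : ExteriorAlgebra ℂ V) :
    contract θ (ExteriorAlgebra.ι ℂ v * X) = θ v • X - ExteriorAlgebra.ι ℂ v * contract θ X :=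
  contractLeft_ι_mul θ v X

theorem contract_algebraMap (r : ℂ) : contract θ (algebraMap ℂ _ r) = 0 :=
  CliffordAlgebra.contractLeft_algebraMap (Q := (0 : QuadraticForm ℂ V)) θ r

theorem contract_mem (k : ℕ) {X : ExteriorAlgebra ℂ V} (hX : X ∈ ⋀[ℂ]^k V) :
    contract θ X ∈ ⋀[ℂ]^(k - 1) V := by
  induction hX using Submodule.pow_induction_on_left' with
  | algebraMap r => rw [contract_algebraMap]; exact Submodule.zero_mem _
  | add X Y i hX hY h1 h2 => rw [map_add]; exact Submodule.add_mem _ h1 h2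
  | mem_mul v hv i X hX ih =>
    obtain ⟨v, rfl⟩ := hv
    rw [contract_ι_mul]
    refine Submodule.sub_mem _ (Submodule.smul_mem _ _ hX) ?_
    rcases i with _ | i
    · rw [pow_zero, Submodule.mem_one] at hX
      obtain ⟨r, rfl⟩ := hX
      rw [contract_algebraMap, mul_zero]
      exact Submodule.zero_mem _
    · change _ ∈ (LinearMap.range (ExteriorAlgebra.ι ℂ)) ^ (i + 1)
      rw [pow_succ']
      exact Submodule.mul_mem_mul (LinearMap.mem_range_self _ v) ih

theorem contract_map (f : W →ₗ[ℂ] V) (X : ExteriorAlgebra ℂ W) :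
    contract θ (ExteriorAlgebra.map f X) = ExteriorAlgebra.map f (contract (θ ∘ₗ f) X) := by
  induction X using ext_induction with
  | hs r => rw [AlgHom.commutes, contract_algebraMap, contract_algebraMap, map_zero]
  | ha X Y hX hY => simp only [map_add, hX, hY]
  | hm v X hX =>
    rw [map_mul, ExteriorAlgebra.map_apply_ι, contract_ι_mul, contract_ι_mul, hX, map_sub, map_smul,
      map_mul, ExteriorAlgebra.map_apply_ι, LinearMap.comp_apply]

theorem contract_smul (a : ℂ) (X : ExteriorAlgebra ℂ V) :
    contract (a • θ) X = a • contract θ X := by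
  simp [contract]

theorem contract_sum {ι : Type*} (s : Finset ι) (θ : ι → V →ₗ[ℂ] ℂ) (X : ExteriorAlgebra ℂ V) :
    contract (∑ i ∈ s, θ i) X = ∑ i ∈ s, contract (θ i) X := by
  simp [contract]

theorem contract_zero (X : ExteriorAlgebra ℂ V) : contract (0 : V →ₗ[ℂ] ℂ) X = 0 := by
  simp [contract]

/-- The image of `⋀^k D` in the exterior algebra of `V`, for a subspace `D` of `V`. -/
def extPow (k : ℕ) (D : Submodule ℂ V) : Submodule ℂ (ExteriorAlgebra ℂ V) :=
  (⋀[ℂ]^k D).map (ExteriorAlgebra.map D.subtype).toLinearMap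

theorem map_mem_pow (f : V →ₗ[ℂ] W) (k : ℕ) {X : ExteriorAlgebra ℂ V} (hX : X ∈ ⋀[ℂ]^k V) :
    ExteriorAlgebra.map f X ∈ ⋀[ℂ]^k W := by
  have : (⋀[ℂ]^k V).map (ExteriorAlgebra.map f).toLinearMap ≤ ⋀[ℂ]^k W := by
    rw [Submodule.map_pow]
    refine pow_le_pow_left' ?_ k
    rintro _ ⟨_, ⟨v, rfl⟩, rfl⟩
    exact ⟨f v, (ExteriorAlgebra.map_apply_ι f v).symm⟩
  exact this ⟨X, hX, rfl⟩

theorem extPow_le (k : ℕ) (D : Submodule ℂ V) : extPow k D ≤ ⋀[ℂ]^k V := by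
  rintro _ ⟨X, hX, rfl⟩
  exact map_mem_pow _ k hX

theorem contract_extPow (k : ℕ) {X : ExteriorAlgebra ℂ V} (hX : X ∈ extPow k (LinearMap.ker θ)) :
    contract θ X = 0 := by
  obtain ⟨X, -, rfl⟩ := hX
  have h : θ ∘ₗ (LinearMap.ker θ).subtype = 0 := LinearMap.comp_ker_subtype θ
  simp only [AlgHom.toLinearMap_apply, contract_map, h, contract_zero, map_zero]

theorem contract_mem_extPow (k : ℕ) {X : ExteriorAlgebra ℂ V} (hX : X ∈ ⋀[ℂ]^k V) :
    contract θ X ∈ extPow (k - 1) (LinearMap.ker θ) := by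
  by_cases hθ : θ = 0
  · rw [hθ, contract_zero]; exact Submodule.zero_mem _
  obtain ⟨e, he⟩ : ∃ e, θ e = 1 := by
    obtain ⟨v, hv⟩ : ∃ v, θ v ≠ 0 := by
      by_contra! h
      exact hθ (LinearMap.ext h)
    exact ⟨(θ v)⁻¹ • v, by simp [hv]⟩
  let q : V →ₗ[ℂ] LinearMap.ker θ :=
    LinearMap.codRestrict _ (LinearMap.id - θ.smulRight e) fun v => by simp [he]
  let p : V →ₗ[ℂ] V := (LinearMap.ker θ).subtype ∘ₗ q
  have hp : ∀ v, ExteriorAlgebra.ι ℂ (p v) =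
      ExteriorAlgebra.ι ℂ v - θ v • ExteriorAlgebra.ι ℂ e := fun v => by
    rw [← map_smul, ← map_sub]; rfl
  have key1 : ∀ Y, ExteriorAlgebra.map p Y = Y - ExteriorAlgebra.ι ℂ e * contract θ Y := by
    intro Y
    induction Y using ext_induction with
    | hs r => rw [AlgHom.commutes, contract_algebraMap, mul_zero, sub_zero]
    | ha X Y hX hY => simp only [map_add, hX, hY, mul_add]; abel
    | hm v X hX =>
      have h1 : ExteriorAlgebra.ι ℂ e * ExteriorAlgebra.ι ℂ v =
          -(ExteriorAlgebra.ι ℂ v * ExteriorAlgebra.ι ℂ e) :=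
        eq_neg_of_add_eq_zero_left (ExteriorAlgebra.ι_add_mul_swap e v)
      have h2 : ExteriorAlgebra.ι ℂ e * ExteriorAlgebra.ι ℂ e = 0 := ExteriorAlgebra.ι_sq_zero e
      rw [map_mul, ExteriorAlgebra.map_apply_ι, hX, contract_ι_mul, hp]
      simp only [sub_mul, mul_sub, smul_mul_assoc, ← mul_assoc, h1, h2, mul_smul_comm, zero_mul,
        neg_mul, smul_zero]
      abel
  have key2 : ∀ Y, ExteriorAlgebra.map p (contract θ Y) = contract θ Y := by
    intro Y
    have h0 : contract θ (contract θ Y) = 0 :=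
      CliffordAlgebra.contractLeft_contractLeft (Q := (0 : QuadraticForm ℂ V)) θ Y
    rw [key1, h0, mul_zero, sub_zero]
  refine ⟨ExteriorAlgebra.map q (contract θ X), map_mem_pow _ _ (contract_mem θ k hX), ?_⟩
  have := key2 X
  rw [← ExteriorAlgebra.map_comp_map] at this
  exact this

end contract

/-! ### The contact structure -/

/-- The `1`-form `z^0 dz^1 - z^1 dz^0 + ⋯ + z^(2n) dz^(2n+1) - z^(2n+1) dz^(2n)` at the point `z`. -/
def contactHom (n : ℕ) (z : Vec (2 * n + 1)) : Vec (2 * n + 1) →ₗ[ℂ] ℂ :=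
  ∑ j : Fin (n + 1),
    (z ⟨2 * j, by omega⟩ • LinearMap.proj ⟨2 * j + 1, by omega⟩ -
      z ⟨2 * j + 1, by omega⟩ • LinearMap.proj ⟨2 * j, by omega⟩)

/-- The local section of the quotient map from nonzero vectors to `ℂP^N`, defined near `x`, which
sends a point to its representative with the same `idx x`-th coordinate as `z`.
If `z` represents `x`, it sends `x` to `z`. -/
def liftThrough {N : ℕ} (x : CP N) (z : Vec N) (y : CP N) : Vec N :=
  (z (idx x) / y.rep (idx x)) • y.rep

/-- The contact form on `ℂP^(2n+1)`: the pullback of the homogeneous `1`-form `contactHom` by a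
local section of the quotient map through the representative `z` of `x`. It is homogeneous of
degree `2` in `z`, that is, it is a form with values in `l^2`. -/
def contactForm {n : ℕ} {x : CP (2 * n + 1)} (z : Line x) : T x →ₗ[ℂ] ℂ :=
  contactHom n z.1 ∘ₗ
    (mfderiv 𝓘(ℂ, Fin (2 * n + 1) → ℂ) 𝓘(ℂ, Vec (2 * n + 1)) (liftThrough x z.1) x :
      T x →L[ℂ] Vec (2 * n + 1)).toLinearMap

/-- The contact distribution: the kernel of the contact form. -/
def contactDist {n : ℕ} (x : CP (2 * n + 1)) : Submodule ℂ (T x) :=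
  ⨅ z : Line x, LinearMap.ker (contactForm z)

/-- The differential of `affineVec`. -/
def affineLin {N : ℕ} (i : Fin (N + 1)) : (Fin N → ℂ) →L[ℂ] Vec N :=
  ContinuousLinearMap.pi fun a => Fin.succAboveCases (α := fun _ => (Fin N → ℂ) →L[ℂ] ℂ) i 0
    (fun j => ContinuousLinearMap.proj j) a

theorem hasFDerivAt_affineVec {N : ℕ} (i : Fin (N + 1)) (w : Fin N → ℂ) :
    HasFDerivAt (affineVec i) (affineLin i) w := by
  rw [hasFDerivAt_pi']
  intro a
  refine Fin.succAboveCases i ?_ (fun j => ?_) a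
  · simp only [affineVec_same]
    refine (hasFDerivAt_const (1 : ℂ) w).congr_fderiv ?_
    ext v; simp [affineLin]
  · simp only [affineVec_succAbove]
    refine (hasFDerivAt_apply (𝕜 := ℂ) j w).congr_fderiv ?_
    ext v; simp [affineLin]

theorem contactHom_self (n : ℕ) (z : Vec (2 * n + 1)) : contactHom n z z = 0 := by
  simp only [contactHom, LinearMap.sum_apply, LinearMap.sub_apply, LinearMap.smul_apply,
    LinearMap.proj_apply, smul_eq_mul]
  exact Finset.sum_eq_zero fun j _ => by ring

theorem contactHom_smul (n : ℕ) (a : ℂ) (z : Vec (2 * n + 1)) :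
    contactHom n (a • z) = a • contactHom n z := by
  simp only [contactHom, Finset.smul_sum, smul_sub, smul_smul, Pi.smul_apply, smul_eq_mul]

/-- The contact form in the chart around `x₀`. -/
theorem contactForm_apply {n : ℕ} {x : CP (2 * n + 1)} (z : Line x) (x₀ : CP (2 * n + 1))
    (hx : x ∈ (chartAt (Fin (2 * n + 1) → ℂ) x₀).source) (v : T x) :
    contactForm z v = z.1 (idx x₀) * contactHom n z.1 (affineLin (idx x₀) (triv x₀ x v)) := by
  obtain ⟨z, hz, hzx⟩ := z
  set i := idx x with hi
  set j := idx x₀ with hj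
  have hzi : z i ≠ 0 := (rep_mk_ne_zero i z hz).1 (by rw [hzx]; exact rep_idx_ne_zero x)
  have hzj : z j ≠ 0 := (rep_mk_ne_zero j z hz).1 (by rw [hzx]; exact hx)
  set w₀ : Fin (2 * n + 1) → ℂ := affineCoord j x with hw₀
  have hw₀' : z j • affineVec j w₀ = z := by
    rw [hw₀, ← hzx, affineCoord_mk]; exact smul_affineVec j z hzj
  have hz0 : affineVec j w₀ = (z j)⁻¹ • z := by
    rw [eq_inv_smul_iff₀ hzj, hw₀']
  have hsi : affineVec j w₀ i = (z j)⁻¹ * z i := by rw [hz0]; rfl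
  have hsi0 : affineVec j w₀ i ≠ 0 := by rw [hsi]; exact mul_ne_zero (inv_ne_zero hzj) hzi
  -- the lift in the chart around `x₀`
  let c : (Fin (2 * n + 1) → ℂ) → ℂ := fun w => z i * (affineVec j w i)⁻¹
  let g : (Fin (2 * n + 1) → ℂ) → Vec (2 * n + 1) := fun w => c w • affineVec j w
  have hA := hasFDerivAt_affineVec j w₀
  have hAi : HasFDerivAt (fun w => affineVec j w i) _ w₀ := (hasFDerivAt_pi'.1 hA) i
  have hc : DifferentiableAt ℂ c w₀ :=
    (hAi.differentiableAt.fun_inv hsi0).const_mul (z i)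
  have hg : HasFDerivAt g
      (c w₀ • affineLin j + (fderiv ℂ c w₀).smulRight (affineVec j w₀)) w₀ :=
    hc.hasFDerivAt.smul hA
  have hcw : c w₀ = z j := by
    change z i * (affineVec j w₀ i)⁻¹ = z j
    rw [hsi]; field_simp
  -- the chart
  have hchart : MDifferentiableAt 𝓘(ℂ, Fin (2 * n + 1) → ℂ) 𝓘(ℂ, Fin (2 * n + 1) → ℂ)
      (extChartAt 𝓘(ℂ, Fin (2 * n + 1) → ℂ) x₀) x := mdifferentiableAt_extChartAt hx
  have hev : liftThrough x z =ᶠ[nhds x] g ∘ extChartAt 𝓘(ℂ, Fin (2 * n + 1) → ℂ) x₀ := by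
    filter_upwards [(chartAt (Fin (2 * n + 1) → ℂ) x₀).open_source.mem_nhds hx] with y hy
    induction y using Projectivization.ind with
    | h u hu =>
      have huj : u j ≠ 0 := (rep_mk_ne_zero j u hu).1 hy
      have h1 : extChartAt 𝓘(ℂ, Fin (2 * n + 1) → ℂ) x₀ (Projectivization.mk ℂ u hu) =
          fun a => u (j.succAbove a) / u j := affineCoord_mk j u hu
      have h2 : affineVec j (fun a => u (j.succAbove a) / u j) = (u j)⁻¹ • u := by
        rw [eq_inv_smul_iff₀ huj, smul_affineVec j u huj]
      obtain ⟨a, ha, h3⟩ := rep_mk u hu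
      simp only [Function.comp_apply, h1, g, c, h2, liftThrough, h3, smul_smul]
      rw [← hi]
      congr 1
      simp only [Pi.smul_apply, smul_eq_mul]
      by_cases hui : u i = 0
      · simp [hui]
      · field_simp
  have hmf := ((hg.hasMFDerivAt.comp x hchart.hasMFDerivAt).congr_of_eventuallyEq hev).mfderiv
  have htriv : mfderiv 𝓘(ℂ, Fin (2 * n + 1) → ℂ) 𝓘(ℂ, Fin (2 * n + 1) → ℂ)
        (extChartAt 𝓘(ℂ, Fin (2 * n + 1) → ℂ) x₀) x v = triv x₀ x v :=
    (congrArg (fun f => f v) (TangentBundle.continuousLinearMapAt_trivializationAt hx)).symm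
  have h4 : contactForm ⟨z, hz, hzx⟩ v = contactHom n z
      ((c w₀ • affineLin j + (fderiv ℂ c w₀).smulRight (affineVec j w₀)) (triv x₀ x v)) := by
    rw [← htriv]
    exact congrArg (fun f => contactHom n z (f v)) hmf
  rw [h4]
  simp only [add_apply, smul_apply, ContinuousLinearMap.smulRight_apply, map_add, map_smul, hcw,
    hz0, contactHom_self, mul_zero, add_zero, smul_eq_mul]

theorem contactForm_smul {n : ℕ} {x : CP (2 * n + 1)} (z z' : Line x) (a : ℂ)
    (h : z'.1 = a • z.1) : contactForm z' = a ^ 2 • contactForm z := by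
  ext v
  rw [LinearMap.smul_apply, contactForm_apply z x (mem_chart_source _ x),
    contactForm_apply z' x (mem_chart_source _ x), h, contactHom_smul]
  simp only [Pi.smul_apply, smul_eq_mul, LinearMap.smul_apply]
  ring

theorem Line.exists_smul {N : ℕ} {x : CP N} (z z' : Line x) : ∃ a : ℂ, z'.1 = a • z.1 := by
  obtain ⟨z, hz, hzx⟩ := z
  obtain ⟨z', hz', hzx'⟩ := z'
  obtain ⟨a, ha⟩ := (Projectivization.mk_eq_mk_iff' ℂ z' z hz' hz).1 (hzx'.trans hzx.symm)
  exact ⟨a, ha.symm⟩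

theorem ker_contactForm {n : ℕ} {x : CP (2 * n + 1)} (z : Line x) :
    LinearMap.ker (contactForm z) = contactDist x := by
  refine le_antisymm (le_iInf fun z' v hv => ?_) (iInf_le _ z)
  obtain ⟨a, ha⟩ := Line.exists_smul z z'
  rw [LinearMap.mem_ker] at hv ⊢
  rw [contactForm_smul z z' a ha, LinearMap.smul_apply, hv, smul_zero]

theorem isHolomorphic_contract {n : ℕ} {U : Opens (CP (2 * n + 1))}
    {σ : ∀ x : U, Line x.1 → ExtT x.1} (hσ : IsHolomorphic σ) :
    IsHolomorphic fun (x : U) (z : Line x.1) => contract (contactForm z) (σ x z) := by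
  intro x₀ φ
  let θ : Vec (2 * n + 1) → (Fin (2 * n + 1) → ℂ) →ₗ[ℂ] ℂ := fun z =>
    z (idx x₀) • contactHom n z ∘ₗ (affineLin (idx x₀)).toLinearMap
  have hθ : ∀ v, Differentiable ℂ fun z => θ z v := fun v => by
    simp only [θ, contactHom, LinearMap.smul_apply, LinearMap.comp_apply, LinearMap.sum_apply,
      LinearMap.sub_apply, LinearMap.proj_apply, smul_eq_mul]
    fun_prop
  have hsum : ∀ z, θ z = ∑ a, θ z (Pi.single a 1) • LinearMap.proj a := fun z => by
    ext a
    simp [Pi.single_apply]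
  have hd : DifferentiableOn ℂ
      (fun z => ∑ a, θ z (Pi.single a 1) *
        (φ ∘ₗ contract (LinearMap.proj a)) (localRep σ x₀ z))
      (cone ((U : Set (CP (2 * n + 1))) ∩ (chartAt (Fin (2 * n + 1) → ℂ) x₀).source)) :=
    DifferentiableOn.fun_sum fun a _ => (hθ _).differentiableOn.mul (hσ x₀ _)
  refine hd.congr fun z hz => ?_
  have h : z ∈ cone (U : Set (CP (2 * n + 1))) := ⟨hz.1, hz.2.1⟩
  have h1 : contactForm (⟨z, h.1, rfl⟩ : Line (Projectivization.mk ℂ z h.1)) =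
      θ z ∘ₗ triv x₀ (Projectivization.mk ℂ z h.1) :=
    LinearMap.ext fun v => contactForm_apply _ x₀ hz.2.2 v
  simp only [localRep, h, dif_pos]
  rw [h1, ← contract_map, hsum z, contract_sum, map_sum]
  simp only [contract_smul, map_smul, smul_eq_mul, LinearMap.comp_apply]
  rw [← hsum z]

theorem contract_mem_fiber {n k : ℕ} {m : ℤ} {x : CP (2 * n + 1)} {f : Line x → ExtT x}
    (hf : f ∈ Fiber m (⋀[ℂ]^k (T x))) :
    (fun z => contract (contactForm z) (f z)) ∈ Fiber (m + 2) (extPow (k - 1) (contactDist x)) := by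
  refine ⟨fun z => ?_, fun z z' a h => ?_⟩
  · have h := contract_mem_extPow (contactForm z) k (hf.1 z)
    rwa [ker_contactForm z] at h
  · have ha : a ≠ 0 := fun h0 => z'.2.1 (by rw [h, h0, zero_smul])
    change contract (contactForm z') (f z') = a ^ (m + 2) • contract (contactForm z) (f z)
    rw [contactForm_smul z z' a h, hf.2 z z' a h, contract_smul, map_smul, smul_smul,
      zpow_add₀ ha, mul_comm (a ^ m)]
    rfl

/-! ### The sequence of sheaves -/

/-- The sheaf `O(l^m ⊗ ⋀^k T)` on `ℂP^(2n+1)`. -/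
def sheafT (n k : ℕ) (m : ℤ) : TopCat.Sheaf (ModuleCat.{0} ℂ) (TopCat.of (CP (2 * n + 1))) :=
  sectionsSheaf m fun x => ⋀[ℂ]^k (T x)

/-- The sheaf `O(l^m ⊗ ⋀^k D)` on `ℂP^(2n+1)`, where `D` is the contact distribution. -/
def sheafD (n k : ℕ) (m : ℤ) : TopCat.Sheaf (ModuleCat.{0} ℂ) (TopCat.of (CP (2 * n + 1))) :=
  sectionsSheaf m fun x => extPow k (contactDist x)

/-- The inclusion `O(l^m ⊗ ⋀^k D) ⟶ O(l^m ⊗ ⋀^k T)`. -/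
def inclusion (n k : ℕ) (m : ℤ) : sheafD n k m ⟶ sheafT n k m :=
  ⟨{ app := fun _ => ModuleCat.ofHom
      { toFun := fun σ => ⟨fun x => ⟨(σ.1 x).1, fun z => extPow_le k _ ((σ.1 x).2.1 z),
          (σ.1 x).2.2⟩, σ.2⟩
        map_add' := fun _ _ => rfl
        map_smul' := fun _ _ => rfl }
     naturality := fun _ _ _ => rfl }⟩

/-- The contraction `γ : O(l^m ⊗ ⋀^k T) ⟶ O(l^(m+2) ⊗ ⋀^(k-1) D)` with the contact form. -/
def gammaMap (n k : ℕ) (m : ℤ) : sheafT n k m ⟶ sheafD n (k - 1) (m + 2) :=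
  ⟨{ app := fun _ => ModuleCat.ofHom
      { toFun := fun σ => ⟨fun x => ⟨fun z => contract (contactForm z) ((σ.1 x).1 z),
          contract_mem_fiber (σ.1 x).2⟩,
          isHolomorphic_contract σ.2⟩
        map_add' := fun σ τ => by
          refine Subtype.ext (funext fun x => Subtype.ext (funext fun z => ?_))
          exact map_add (contract (contactForm z)) ((σ.1 x).1 z) ((τ.1 x).1 z)
        map_smul' := fun c σ => by
          refine Subtype.ext (funext fun x => Subtype.ext (funext fun z => ?_))
          exact map_smul (contract (contactForm z)) c ((σ.1 x).1 z) }
     naturality := fun _ _ _ => rfl }⟩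

/-- The sequence `O(l^m ⊗ ⋀^k D) ⟶ O(l^m ⊗ ⋀^k T) ⟶ O(l^(m+2) ⊗ ⋀^(k-1) D)` of sheaves of complex
vector spaces on `ℂP^(2n+1)`. -/
def contactSeq (n k : ℕ) (m : ℤ) :
    ShortComplex (Sheaf (Opens.grothendieckTopology (CP (2 * n + 1))) (ModuleCat.{0} ℂ)) where
  X₁ := sheafD n k m
  X₂ := sheafT n k m
  X₃ := sheafD n (k - 1) (m + 2)
  f := inclusion n k m
  g := gammaMap n k m
  zero := by
    ext U σ
    refine Subtype.ext (funext fun x => Subtype.ext (funext fun z => ?_))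
    have h : (σ.1 x).1 z ∈ extPow k (contactDist x.1) := (σ.1 x).2.1 z
    rw [← ker_contactForm z] at h
    exact contract_extPow _ k h

/-- The `i`-th cohomology group of `ℂP^(2n+1)`, as a functor on sheaves of complex vector spaces. -/
def cohomology (n i : ℕ) :
    Sheaf (Opens.grothendieckTopology (CP (2 * n + 1))) (ModuleCat.{0} ℂ) ⥤ AddCommGrpCat.{0} :=
  sheafCompose _ (forget₂ (ModuleCat.{0} ℂ) AddCommGrpCat.{0}) ⋙ Sheaf.functorH _ i

instance (n : ℕ) : (sheafCompose (Opens.grothendieckTopology (CP (2 * n + 1)))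
    (forget₂ (ModuleCat.{0} ℂ) AddCommGrpCat.{0})).Additive where
  map_add := rfl

instance (n i : ℕ) : (cohomology n i).Additive :=
  inferInstanceAs (sheafCompose _ (forget₂ (ModuleCat.{0} ℂ) AddCommGrpCat.{0}) ⋙
    Sheaf.functorH _ i).Additive

end

end ContactCP

/-! It suffices to split γ by a morphism of sheaves of ℂ-modules, which may be a differential
operator and need not be 𝒪-linear: additive functors preserve splittings, so the cohomology
sequences are then exact as well. Put k = q + 1. A section of l^(m+2) ⊗ ⋀^q D lifts locally to a
polyvector field P on the cone in ℂ^(2n+2), homogeneous of degree d = m + 2 + q, unique modulo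
multiples of z and killed by contraction with ω(z, ·). Here ω is the symplectic form with γ = ω(z,
dz).

The form ω turns polyvectors into differential forms: contraction with ω(z, ·) becomes contraction
with the Euler field, the vector z becomes γ up to sign, and `SymplecticForm.D` becomes the exterior
derivative. As in Cartan's formula, contracting D P gives (d + q) P, so (d + q)⁻¹ D almost splits γ.
However D (z ∧ Q) is L Q modulo z, so D P depends on the choice of the lift. The divergence sends z
∧ Q to c Q modulo z, with c = 2n + 2 - q + d when z ∧ Q has degree q and coefficients of degree d.
Hence `T` = D - c⁻¹ L div no longer depends on the lift modulo z.

Contracting T P leaves the error -c⁻¹ L Λ P modulo z. It is cancelled by adding c⁻¹ L applied to the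
splitting of Λ P, which has degree q - 2. This recursion is `splitOp`: `ι_mul_contract_splitOp`
shows that it inverts the contraction modulo z, and `ι_mul_splitOp` that it does not see the choice
of the lift. Its denominators are collected in `IsRegular`, and the conditions on m and k keep them
away from zero. -/

namespace ContactCP

/-! ### Derivatives of holomorphic functions of several variables -/

/-- The directional derivative of a holomorphic function of several variables is holomorphic. -/
theorem differentiableOn_fderiv_apply {n : ℕ} {f : (Fin n → ℂ) → ℂ} {s : Set (Fin n → ℂ)}
    (hs : IsOpen s) (hf : DifferentiableOn ℂ f s) (v : Fin n → ℂ) :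
    DifferentiableOn ℂ (fun z => fderiv ℂ f z v) s := by
  intro z₀ hz₀
  refine DifferentiableAt.differentiableWithinAt ?_
  have hfz : DifferentiableAt ℂ f z₀ := hf.differentiableAt (hs.mem_nhds hz₀)
  obtain ⟨ε, hε, hball⟩ : ∃ ε > 0, Metric.ball z₀ ε ⊆ s ∩ f ⁻¹' Metric.ball (f z₀) 1 :=
    Metric.mem_nhds_iff.1 (Filter.inter_mem (hs.mem_nhds hz₀)
      (hfz.continuousAt.preimage_mem_nhds (Metric.ball_mem_nhds _ one_pos)))
  -- The three parts of ε: x within ρ of z₀, a displacement ζ • v shorter than ρ, and a ball of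
  -- radius ρ for the Cauchy estimate. The `+ 1` in r allows v = 0.
  set ρ := ε / 3 with hρ
  have hρ0 : 0 < ρ := by positivity
  set r := ρ / (‖v‖ + 1) with hr
  have hr0 : 0 < r := by positivity
  have hrv : r * ‖v‖ < ρ := by
    rw [hr, div_mul_eq_mul_div, div_lt_iff₀ (by positivity)]
    nlinarith [norm_nonneg v]
  have hmem : ∀ x ∈ Metric.ball z₀ ρ, ∀ ζ : ℂ, ‖ζ‖ ≤ r → x + ζ • v ∈ Metric.ball z₀ (2 * ρ) := by
    intro x hx ζ hζ
    rw [mem_ball_iff_norm] at hx ⊢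
    calc ‖x + ζ • v - z₀‖ = ‖(x - z₀) + ζ • v‖ := by congr 1; abel
      _ ≤ ‖x - z₀‖ + ‖ζ‖ * ‖v‖ := (norm_add_le _ _).trans (by rw [norm_smul])
      _ ≤ ‖x - z₀‖ + r * ‖v‖ := by gcongr
      _ < 2 * ρ := by linarith
  have hsub : ∀ y ∈ Metric.ball z₀ (2 * ρ), Metric.ball y ρ ⊆ Metric.ball z₀ ε := fun y hy =>
    Metric.ball_subset_ball' (by rw [Metric.mem_ball] at hy; linarith)
  have hdiff : ∀ y ∈ Metric.ball z₀ (2 * ρ), DifferentiableAt ℂ f y := fun y hy =>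
    hf.differentiableAt (hs.mem_nhds (hball (hsub y hy (Metric.mem_ball_self hρ0))).1)
  -- All values of f on the large ball are within 1 of f z₀, hence within 2 of each other.
  have hbound : ∀ y ∈ Metric.ball z₀ (2 * ρ), ‖fderiv ℂ f y‖ ≤ 2 / ρ := fun y hy => by
    refine Complex.norm_fderiv_le_div_of_mapsTo_ball
      (hf.mono fun w hw => (hball (hsub y hy hw)).1) (fun w hw => ?_) hρ0
    have h1 : dist (f w) (f z₀) < 1 := (hball (hsub y hy hw)).2
    have h2 : dist (f y) (f z₀) < 1 := (hball (hsub y hy (Metric.mem_ball_self hρ0))).2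
    rw [Metric.mem_closedBall]
    linarith [dist_triangle_right (f w) (f y) (f z₀)]
  -- Cauchy's formula for the directional derivative
  have hcauchy : ∀ x ∈ Metric.ball z₀ ρ, fderiv ℂ f x v = (2 * Real.pi * Complex.I : ℂ)⁻¹ •
      ∮ ζ in C(0, r), ((ζ - 0) ^ 2)⁻¹ • f (x + ζ • v) := by
    intro x hx
    let U : Set ℂ := (fun ζ : ℂ => x + ζ • v) ⁻¹' Metric.ball z₀ (2 * ρ)
    have hU : IsOpen U := Metric.isOpen_ball.preimage (by fun_prop)
    have hline : ∀ ζ : ℂ, HasDerivAt (fun ζ : ℂ => x + ζ • v) v ζ := fun ζ => by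
      simpa using ((hasDerivAt_id ζ).smul_const v).const_add x
    have hd : DifferentiableOn ℂ (fun ζ : ℂ => f (x + ζ • v)) U := fun ζ hζ =>
      ((hdiff _ hζ).comp ζ (hline ζ).differentiableAt).differentiableWithinAt
    have := Complex.two_pi_I_inv_smul_circleIntegral_sub_sq_inv_smul_of_differentiable hU
      (c := 0) (R := r) (fun ζ hζ => hmem x hx ζ (by simpa using hζ)) hd
      (Metric.mem_ball_self hr0)
    rw [this]
    have hx0 : HasFDerivAt f (fderiv ℂ f x) (x + (0 : ℂ) • v) := by
      rw [zero_smul, add_zero]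
      exact (hdiff x (Metric.ball_subset_ball (by linarith) hx)).hasFDerivAt
    exact (hx0.comp_hasDerivAt (0 : ℂ) (hline 0)).deriv.symm
  have hcirc : Continuous fun θ : ℝ => circleMap 0 r θ := continuous_circleMap 0 r
  have hcnorm : ∀ θ, ‖circleMap 0 r θ‖ = r := fun θ => by simp [abs_of_pos hr0]
  have hcne : ∀ θ, circleMap 0 r θ ≠ 0 := fun θ h => by
    have := hcnorm θ; rw [h, norm_zero] at this; exact hr0.ne this
  let g : ℝ → ℂ := fun θ => deriv (circleMap 0 r) θ * ((circleMap 0 r θ - 0) ^ 2)⁻¹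
  have hg : Continuous g := by
    simp only [g, deriv_circleMap, sub_zero]
    exact (hcirc.mul continuous_const).mul ((hcirc.pow 2).inv₀ fun θ => pow_ne_zero 2 (hcne θ))
  have hcont : ∀ x ∈ Metric.ball z₀ ρ, Continuous fun θ : ℝ => f (x + circleMap 0 r θ • v) := by
    intro x hx
    rw [continuous_iff_continuousAt]
    intro θ
    exact ContinuousAt.comp (f := fun θ => x + circleMap 0 r θ • v)
      (hdiff _ (hmem x hx _ (hcnorm θ).le)).continuousAt
      (by fun_prop)
  have key : HasFDerivAt (fun x => ∫ θ in (0 : ℝ)..2 * Real.pi, g θ • f (x + circleMap 0 r θ • v))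
      (∫ θ in (0 : ℝ)..2 * Real.pi, g θ • fderiv ℂ f (z₀ + circleMap 0 r θ • v)) z₀ := by
    refine intervalIntegral.hasFDerivAt_integral_of_dominated_of_fderiv_le
      (F' := fun x θ => g θ • fderiv ℂ f (x + circleMap 0 r θ • v))
      (bound := fun θ => ‖g θ‖ * (2 / ρ))
      (Metric.ball_mem_nhds z₀ hρ0) ?_ ?_ ?_ ?_ ?_ ?_
    · filter_upwards [Metric.ball_mem_nhds z₀ hρ0] with x hx
      exact (hg.smul (hcont x hx)).aestronglyMeasurable
    · exact (hg.smul (hcont z₀ (Metric.mem_ball_self hρ0))).intervalIntegrable _ _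
    -- The Fréchet derivative is measurable for any function, so its continuity, not yet known, is
    -- not needed.
    · refine AEMeasurable.aestronglyMeasurable (Measurable.aemeasurable ?_)
      have h1 : Measurable fun θ : ℝ => z₀ + circleMap 0 r θ • v :=
        Continuous.measurable (by fun_prop)
      exact hg.measurable.smul ((measurable_fderiv ℂ f).comp h1)
    · refine Filter.Eventually.of_forall fun θ _ x hx => ?_
      rw [norm_smul]
      exact mul_le_mul_of_nonneg_left (hbound _ (hmem x hx _ (hcnorm θ).le)) (norm_nonneg _)
    · exact (hg.norm.mul continuous_const).intervalIntegrable _ _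
    · refine Filter.Eventually.of_forall fun θ _ x hx => ?_
      have h1 := (hdiff _ (hmem x hx _ (hcnorm θ).le)).hasFDerivAt
      exact ((hasFDerivAt_comp_add_right _).2 h1).const_smul (g θ)
  refine ((key.differentiableAt.const_smul (2 * Real.pi * Complex.I : ℂ)⁻¹)).congr_of_eventuallyEq ?_
  filter_upwards [Metric.ball_mem_nhds z₀ hρ0] with x hx
  rw [hcauchy x hx]
  simp only [circleIntegral, g, smul_eq_mul, Pi.smul_apply, mul_assoc]

end ContactCP

namespace ContactCP

noncomputable section

/-! ### Weakly holomorphic functions -/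

section weak

variable {n : ℕ} {W W' : Type*} [AddCommGroup W] [Module ℂ W] [AddCommGroup W'] [Module ℂ W']

/-- Differentiability at a point of a function with values in a space without topology, tested by
linear forms. -/
def WeakDiffAt (P : (Fin n → ℂ) → W) (z : Fin n → ℂ) : Prop :=
  ∀ φ : Module.Dual ℂ W, DifferentiableAt ℂ (fun y => φ (P y)) z

theorem WeakDiffAt.add {P Q : (Fin n → ℂ) → W} {z : Fin n → ℂ} (hP : WeakDiffAt P z)
    (hQ : WeakDiffAt Q z) : WeakDiffAt (fun y => P y + Q y) z := fun φ => by
  simpa only [map_add] using (hP φ).fun_add (hQ φ)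

theorem WeakDiffAt.smul {f : (Fin n → ℂ) → ℂ} {P : (Fin n → ℂ) → W} {z : Fin n → ℂ}
    (hf : DifferentiableAt ℂ f z) (hP : WeakDiffAt P z) :
    WeakDiffAt (fun y => f y • P y) z := fun φ => by
  simpa only [map_smul, smul_eq_mul] using hf.fun_mul (hP φ)

theorem WeakDiffAt.const_smul (c : ℂ) {P : (Fin n → ℂ) → W} {z : Fin n → ℂ}
    (hP : WeakDiffAt P z) : WeakDiffAt (fun y => c • P y) z :=
  WeakDiffAt.smul (differentiableAt_const c) hP

theorem WeakDiffAt.sub {P Q : (Fin n → ℂ) → W} {z : Fin n → ℂ} (hP : WeakDiffAt P z)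
    (hQ : WeakDiffAt Q z) : WeakDiffAt (fun y => P y - Q y) z := fun φ => by
  simpa only [map_sub] using (hP φ).fun_sub (hQ φ)

theorem WeakDiffAt.linear (T : W →ₗ[ℂ] W') {P : (Fin n → ℂ) → W} {z : Fin n → ℂ}
    (hP : WeakDiffAt P z) : WeakDiffAt (fun y => T (P y)) z := fun φ => hP (φ ∘ₗ T)

theorem WeakDiffAt.sum {ι : Type*} (s : Finset ι) {P : ι → (Fin n → ℂ) → W} {z : Fin n → ℂ}
    (hP : ∀ i ∈ s, WeakDiffAt (P i) z) : WeakDiffAt (fun y => ∑ i ∈ s, P i y) z := fun φ => by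
  simpa only [map_sum] using DifferentiableAt.fun_sum fun i hi => hP i hi φ

theorem WeakDiffAt.congr {P Q : (Fin n → ℂ) → W} {z : Fin n → ℂ}
    (hP : WeakDiffAt P z) (h : Q =ᶠ[nhds z] P) : WeakDiffAt Q z := fun φ =>
  (hP φ).congr_of_eventuallyEq (h.fun_comp φ)

theorem bilin_eq_sum (B : (Fin n → ℂ) →ₗ[ℂ] W →ₗ[ℂ] W') (y : Fin n → ℂ) (X : W) :
    B y X = ∑ a, y a • B (Pi.single a 1) X := by
  conv_lhs => rw [pi_eq_sum_univ' y]
  simp only [map_sum, map_smul, LinearMap.sum_apply, LinearMap.smul_apply]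

theorem WeakDiffAt.bilin (B : (Fin n → ℂ) →ₗ[ℂ] W →ₗ[ℂ] W') {P : (Fin n → ℂ) → W}
    {z : Fin n → ℂ} (hP : WeakDiffAt P z) : WeakDiffAt (fun y => B y (P y)) z := by
  rw [show (fun y => B y (P y)) = fun y => ∑ a, y a • B (Pi.single a 1) (P y) from
    funext fun y => bilin_eq_sum B y (P y)]
  exact WeakDiffAt.sum _ fun a _ => WeakDiffAt.smul (differentiableAt_apply a z) (hP.linear _)

variable [Module.Finite ℂ W] [Module.Finite ℂ W']

/-- The directional derivative of a function with values in a finite-dimensional space. -/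
def pd (P : (Fin n → ℂ) → W) (z v : Fin n → ℂ) : W :=
  ∑ s, fderiv ℂ (fun y => (Module.finBasis ℂ W).coord s (P y)) z v • Module.finBasis ℂ W s

/-- Frees `pd` from the basis chosen in its definition; every later rule is checked against linear
forms. -/
theorem dual_pd {P : (Fin n → ℂ) → W} {z : Fin n → ℂ} (hP : WeakDiffAt P z)
    (φ : Module.Dual ℂ W) (v : Fin n → ℂ) :
    φ (pd P z v) = fderiv ℂ (fun y => φ (P y)) z v := by
  have h : (fun y => φ (P y)) = fun y => ∑ s, (Module.finBasis ℂ W).coord s (P y) *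
      φ (Module.finBasis ℂ W s) := by
    funext y
    conv_lhs => rw [← (Module.finBasis ℂ W).sum_repr (P y)]
    simp only [map_sum, map_smul, smul_eq_mul, Module.Basis.coord_apply]
  rw [h, fderiv_fun_sum fun s _ => (hP _).mul_const _]
  simp only [pd, map_sum, map_smul, smul_eq_mul, sum_apply]
  refine Finset.sum_congr rfl fun s _ => ?_
  rw [fderiv_mul_const (hP _)]
  simp [mul_comm]

theorem ext_dual {X Y : W} (h : ∀ φ : Module.Dual ℂ W, φ X = φ Y) : X = Y := by
  rw [← sub_eq_zero, ← Module.forall_dual_apply_eq_zero_iff ℂ]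
  intro φ
  rw [map_sub, h, sub_self]

theorem pd_linear (T : W →ₗ[ℂ] W') {P : (Fin n → ℂ) → W} {z : Fin n → ℂ} (hP : WeakDiffAt P z)
    (v : Fin n → ℂ) : pd (fun y => T (P y)) z v = T (pd P z v) := ext_dual fun φ => by
  rw [dual_pd (hP.linear T)]
  exact (dual_pd hP (φ ∘ₗ T) v).symm

theorem pd_add {P Q : (Fin n → ℂ) → W} {z : Fin n → ℂ} (hP : WeakDiffAt P z)
    (hQ : WeakDiffAt Q z) (v : Fin n → ℂ) :
    pd (fun y => P y + Q y) z v = pd P z v + pd Q z v := ext_dual fun φ => by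
  rw [dual_pd (hP.add hQ), map_add, dual_pd hP, dual_pd hQ]
  simp only [map_add]
  rw [fderiv_fun_add (hP φ) (hQ φ)]
  rfl

theorem pd_const_smul (c : ℂ) {P : (Fin n → ℂ) → W} {z : Fin n → ℂ} (hP : WeakDiffAt P z)
    (v : Fin n → ℂ) : pd (fun y => c • P y) z v = c • pd P z v :=
  pd_linear (LinearMap.lsmul ℂ W c) hP v

theorem pd_congr {P Q : (Fin n → ℂ) → W} {z : Fin n → ℂ} (h : P =ᶠ[nhds z] Q) (v : Fin n → ℂ) :
    pd P z v = pd Q z v := by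
  simp only [pd]
  refine Finset.sum_congr rfl fun s _ => ?_
  have hs : (fun y => (Module.finBasis ℂ W).coord s (P y)) =ᶠ[nhds z]
      fun y => (Module.finBasis ℂ W).coord s (Q y) := h.fun_comp _
  rw [hs.fderiv_eq]

/-- Leibniz rule with the position vector as one factor. It serves for both y ∧ P y and the
contraction of P y with ω(y, ·). -/
theorem pd_bilin (B : (Fin n → ℂ) →ₗ[ℂ] W →ₗ[ℂ] W') {P : (Fin n → ℂ) → W} {z : Fin n → ℂ}
    (hP : WeakDiffAt P z) (v : Fin n → ℂ) :
    pd (fun y => B y (P y)) z v = B v (P z) + B z (pd P z v) := ext_dual fun φ => by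
  rw [dual_pd (hP.bilin B)]
  have h : (fun y => φ (B y (P y))) =
      fun y => ∑ a, y a * (φ ∘ₗ B (Pi.single a 1)) (P y) := by
    funext y
    rw [bilin_eq_sum B]
    simp
  rw [h, fderiv_fun_sum fun a _ => (differentiableAt_apply a z).fun_mul (hP _), bilin_eq_sum B v,
    bilin_eq_sum B z, ← Finset.sum_add_distrib, map_sum, sum_apply]
  refine Finset.sum_congr rfl fun a _ => ?_
  rw [fderiv_fun_mul (differentiableAt_apply a z) (hP _)]
  have := dual_pd hP (φ ∘ₗ B (Pi.single a 1)) v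
  simp only [add_apply, smul_apply, smul_eq_mul, map_add, map_smul]
  rw [← this, (hasFDerivAt_apply (𝕜 := ℂ) a z).fderiv]
  simp [mul_comm, add_comm]

theorem pd_eq_sum (P : (Fin n → ℂ) → W) (z v : Fin n → ℂ) :
    pd P z v = ∑ a, v a • pd P z (Pi.single a 1) := by
  simp only [pd, Finset.smul_sum]
  rw [Finset.sum_comm]
  refine Finset.sum_congr rfl fun s _ => ?_
  conv_lhs => rw [pi_eq_sum_univ' v]
  simp only [map_sum, map_smul, Finset.sum_smul, smul_assoc]

/-- A subspace is cut out by the linear forms vanishing on it, and these commute with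
differentiation. Hence differentiation preserves the degree of polyvectors. -/
theorem pd_mem {P : (Fin n → ℂ) → W} {z : Fin n → ℂ} (hP : WeakDiffAt P z) (F : Submodule ℂ W)
    (hF : ∀ᶠ y in nhds z, P y ∈ F) (v : Fin n → ℂ) : pd P z v ∈ F := by
  rw [← Subspace.dualAnnihilator_dualCoannihilator_eq (W := F), Submodule.mem_dualCoannihilator]
  intro φ hφ
  rw [Submodule.mem_dualAnnihilator] at hφ
  have : (fun y => φ (P y)) =ᶠ[nhds z] fun _ => 0 := hF.mono fun y hy => hφ _ hy
  rw [dual_pd hP, this.fderiv_eq]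
  simp

/-- Here complex differentiability is essential: derivatives of holomorphic functions are
holomorphic, so differential operators preserve holomorphic fields. -/
theorem WeakDiffAt.pd {P : (Fin n → ℂ) → W} {Ω : Set (Fin n → ℂ)} (hΩ : IsOpen Ω)
    (hP : ∀ z ∈ Ω, WeakDiffAt P z) (v : Fin n → ℂ) {z : Fin n → ℂ} (hz : z ∈ Ω) :
    WeakDiffAt (fun y => pd P y v) z := fun φ => by
  have h := differentiableOn_fderiv_apply hΩ
    (fun y hy => (hP y hy φ).differentiableWithinAt) v
  refine (h.differentiableAt (hΩ.mem_nhds hz)).congr_of_eventuallyEq ?_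
  filter_upwards [hΩ.mem_nhds hz] with y hy
  exact dual_pd (hP y hy) φ v

/-- Euler's relation. -/
theorem pd_euler {P : (Fin n → ℂ) → W} {z : Fin n → ℂ} (hP : WeakDiffAt P z) (d : ℤ)
    (h : ∀ a : ℂ, a ≠ 0 → P (a • z) = a ^ d • P z) : pd P z z = (d : ℂ) • P z :=
  ext_dual fun φ => by
  rw [dual_pd hP, map_smul, smul_eq_mul]
  have h1 : HasDerivAt (fun a : ℂ => a • z) z 1 := by
    simpa using (hasDerivAt_id (1 : ℂ)).smul_const z
  have h2 : HasFDerivAt (fun y => φ (P y)) (fderiv ℂ (fun y => φ (P y)) z) ((1 : ℂ) • z) := by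
    rw [one_smul]; exact (hP φ).hasFDerivAt
  have h3 := h2.comp_hasDerivAt (1 : ℂ) h1
  have h4 : HasDerivAt (fun a : ℂ => a ^ d * φ (P z)) (d * φ (P z)) 1 := by
    simpa using (hasDerivAt_zpow d (1 : ℂ) (Or.inl one_ne_zero)).mul_const (φ (P z))
  refine h3.unique (h4.congr_of_eventuallyEq ?_)
  filter_upwards [isOpen_ne.mem_nhds (one_ne_zero : (1 : ℂ) ≠ 0)] with a ha
  simp [h a ha]

/-- Differentiate P (a • y) = a ^ d • P y in y; the chain rule absorbs one factor a. -/
theorem pd_smul_point {P : (Fin n → ℂ) → W} {z : Fin n → ℂ} (d : ℤ) {a : ℂ} (ha : a ≠ 0)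
    (hP : WeakDiffAt P z) (hPa : WeakDiffAt P (a • z))
    (h : ∀ᶠ y in nhds z, P (a • y) = a ^ d • P y) (v : Fin n → ℂ) :
    pd P (a • z) v = a ^ (d - 1) • pd P z v := ext_dual fun φ => by
  rw [dual_pd hPa, map_smul, dual_pd hP, smul_eq_mul, zpow_sub_one₀ ha]
  have h1 : HasFDerivAt (fun y : Fin n → ℂ => a • y) (a • ContinuousLinearMap.id ℂ _) z :=
    (hasFDerivAt_id z).const_smul a
  have h2 := (hPa φ).hasFDerivAt.comp z h1
  have h3 : HasFDerivAt (fun y => a ^ d * φ (P y)) (a ^ d • fderiv ℂ (fun y => φ (P y)) z) z :=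
    (hP φ).hasFDerivAt.const_mul (a ^ d)
  have h4 := h2.unique (h3.congr_of_eventuallyEq (h.mono fun y hy => by simp [hy]))
  have h5 := congrArg (fun f => f v) h4
  simp only [ContinuousLinearMap.comp_apply, smul_apply, ContinuousLinearMap.id_apply,
    map_smul, smul_eq_mul] at h5
  field_simp
  rw [← h5]
  ring

end weak

end

end ContactCP

namespace ContactCP

noncomputable section

open ExteriorAlgebra (ι)

/-! ### Exterior algebra -/

section algebra

variable {V W : Type*} [AddCommGroup V] [Module ℂ V] [AddCommGroup W] [Module ℂ W]

theorem ι_mul_swap (u v : V) (X : ExteriorAlgebra ℂ V) :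
    ι ℂ u * (ι ℂ v * X) = -(ι ℂ v * (ι ℂ u * X)) := by
  rw [← mul_assoc, ← mul_assoc, ← neg_mul,
    eq_neg_of_add_eq_zero_left (ExteriorAlgebra.ι_add_mul_swap u v)]

theorem ι_mul_self_mul (u : V) (X : ExteriorAlgebra ℂ V) : ι ℂ u * (ι ℂ u * X) = 0 := by
  rw [← mul_assoc, ExteriorAlgebra.ι_sq_zero, zero_mul]

theorem contract_comm (θ η : V →ₗ[ℂ] ℂ) (X : ExteriorAlgebra ℂ V) :
    contract θ (contract η X) = -contract η (contract θ X) :=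
  CliffordAlgebra.contractLeft_comm (Q := (0 : QuadraticForm ℂ V)) θ η X

theorem contract_eq_zero (θ : V →ₗ[ℂ] ℂ) {X : ExteriorAlgebra ℂ V} (hX : X ∈ ⋀[ℂ]^0 V) :
    contract θ X = 0 := by
  rw [ExteriorAlgebra.exteriorPower, pow_zero, Submodule.mem_one] at hX
  obtain ⟨r, rfl⟩ := hX
  exact contract_algebraMap θ r

theorem ι_mul_mem (v : V) {q : ℕ} {X : ExteriorAlgebra ℂ V} (hX : X ∈ ⋀[ℂ]^q V) :
    ι ℂ v * X ∈ ⋀[ℂ]^(q + 1) V := by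
  rw [ExteriorAlgebra.exteriorPower, pow_succ']
  exact Submodule.mul_mem_mul (LinearMap.mem_range_self _ v) hX

theorem contract_mem_pred (θ : V →ₗ[ℂ] ℂ) {q : ℕ} {X : ExteriorAlgebra ℂ V}
    (hX : X ∈ ⋀[ℂ]^(q + 1) V) : contract θ X ∈ ⋀[ℂ]^q V :=
  contract_mem θ (q + 1) hX

/-- The degree, as a sum of products of multiplications and contractions. -/
theorem sum_ι_mul_contract {I : Type*} [Fintype I] (v : I → V) (θ : I → V →ₗ[ℂ] ℂ)
    (h : ∀ u, ∑ i, θ i u • v i = u) {q : ℕ} {X : ExteriorAlgebra ℂ V} (hX : X ∈ ⋀[ℂ]^q V) :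
    ∑ i, ι ℂ (v i) * contract (θ i) X = (q : ℂ) • X := by
  induction hX using Submodule.pow_induction_on_left' with
  | algebraMap r => simp [contract_algebraMap]
  | add X Y i hX hY h1 h2 => simp only [map_add, mul_add, Finset.sum_add_distrib, h1, h2, smul_add]
  | mem_mul w hw i X hX ih =>
    obtain ⟨w, rfl⟩ := hw
    have h1 : ∀ j, ι ℂ (v j) * contract (θ j) (ι ℂ w * X) =
        ι ℂ (θ j w • v j) * X + ι ℂ w * (ι ℂ (v j) * contract (θ j) X) := fun j => by
      rw [contract_ι_mul, mul_sub, ι_mul_swap (v j), map_smul]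
      simp
    simp only [h1, Finset.sum_add_distrib, ← Finset.mul_sum, ih, ← Finset.sum_mul, ← map_sum, h w]
    rw [mul_smul_comm]
    push_cast
    rw [add_smul, one_smul, add_comm]

/-- An element killed by multiplication with a vector is a multiple of that vector. -/
theorem eq_ι_mul_contract {v : V} {ξ : V →ₗ[ℂ] ℂ} (hξ : ξ v = 1) {X : ExteriorAlgebra ℂ V}
    (hX : ι ℂ v * X = 0) : X = ι ℂ v * contract ξ X := by
  have := contract_ι_mul ξ v X
  rw [hX, map_zero, hξ, one_smul] at this
  exact sub_eq_zero.1 this.symm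

/-- An element killed by v is a multiple of v. This is why identities modulo z on the cone suffice
downstairs, where the differential of the projection kills z. -/
theorem map_eq_zero_of_ι_mul {v : V} {ξ : V →ₗ[ℂ] ℂ} (hξ : ξ v = 1) (f : V →ₗ[ℂ] W) (hf : f v = 0)
    {X : ExteriorAlgebra ℂ V} (hX : ι ℂ v * X = 0) : ExteriorAlgebra.map f X = 0 := by
  rw [eq_ι_mul_contract hξ hX, map_mul, ExteriorAlgebra.map_apply_ι, hf, map_zero, zero_mul]

/-- Multiplying by v tests equality modulo v, and the two maps agree modulo v on vectors, hence on
products. -/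
theorem ι_mul_map_congr (f g : W →ₗ[ℂ] V) (v : V) (h : ∀ w, ∃ c : ℂ, f w = g w + c • v)
    (X : ExteriorAlgebra ℂ W) :
    ι ℂ v * ExteriorAlgebra.map f X = ι ℂ v * ExteriorAlgebra.map g X := by
  induction X using ext_induction with
  | hs r => simp
  | ha X Y hX hY => simp only [map_add, mul_add, hX, hY]
  | hm w X hX =>
    obtain ⟨c, hc⟩ := h w
    rw [map_mul, map_mul, ExteriorAlgebra.map_apply_ι, ExteriorAlgebra.map_apply_ι, ι_mul_swap, hX,
      ι_mul_swap, hc, map_add, map_smul, add_mul, smul_mul_assoc, mul_add, mul_smul_comm]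
    simp [ι_mul_self_mul]

theorem map_smul_apply (c : ℂ) (f : W →ₗ[ℂ] V) {q : ℕ} {X : ExteriorAlgebra ℂ W}
    (hX : X ∈ ⋀[ℂ]^q W) : ExteriorAlgebra.map (c • f) X = c ^ q • ExteriorAlgebra.map f X := by
  induction hX using Submodule.pow_induction_on_left' with
  | algebraMap r => simp
  | add X Y i hX hY h1 h2 => simp only [map_add, h1, h2, smul_add]
  | mem_mul w hw i X hX ih =>
    obtain ⟨w, rfl⟩ := hw
    simp only [map_mul, ExteriorAlgebra.map_apply_ι, ih, LinearMap.smul_apply, map_smul,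
      smul_mul_assoc, mul_smul_comm, smul_smul, pow_succ]

/-- The perturbation has rank one and e ∧ e = 0, so only its linear term survives. -/
theorem map_sub_smulRight {ξ : V →ₗ[ℂ] ℂ} {e : V} (X : ExteriorAlgebra ℂ V) :
    ExteriorAlgebra.map (LinearMap.id - ξ.smulRight e) X = X - ι ℂ e * contract ξ X := by
  induction X using ext_induction with
  | hs r => rw [AlgHom.commutes, contract_algebraMap, mul_zero, sub_zero]
  | ha X Y hX hY => simp only [map_add, hX, hY, mul_add]; abel
  | hm v X hX =>
    rw [map_mul, ExteriorAlgebra.map_apply_ι, hX, contract_ι_mul, mul_sub (ι ℂ e), ι_mul_swap e v]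
    simp only [LinearMap.sub_apply, LinearMap.id_apply, LinearMap.smulRight_apply, map_sub,
      map_smul, sub_mul, mul_sub, smul_mul_assoc, mul_smul_comm, ι_mul_self_mul]
    simp
    abel

/-- Multiplication by a vector, as a bilinear map. -/
def wedge : V →ₗ[ℂ] ExteriorAlgebra ℂ V →ₗ[ℂ] ExteriorAlgebra ℂ V :=
  LinearMap.mul ℂ (ExteriorAlgebra ℂ V) ∘ₗ ι ℂ

theorem wedge_apply (v : V) (X : ExteriorAlgebra ℂ V) : wedge v X = ι ℂ v * X := rfl

/-- Contraction, as a bilinear map. -/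
def contractHom : (V →ₗ[ℂ] ℂ) →ₗ[ℂ] ExteriorAlgebra ℂ V →ₗ[ℂ] ExteriorAlgebra ℂ V :=
  CliffordAlgebra.contractLeft (Q := (0 : QuadraticForm ℂ V))

end algebra

instance {m : ℕ} : Module.Finite ℂ (ExteriorAlgebra ℂ (Fin m → ℂ)) :=
  Module.Finite.of_basis (Pi.basisFun ℂ (Fin m)).ExteriorAlgebra

/-! ### Polyvector fields on a symplectic vector space -/

/-- A symplectic form on `ℂ^m`, with the vectors dual to the coordinate functions. -/
structure SymplecticForm (m : ℕ) where
  /-- The form. -/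
  form : (Fin m → ℂ) →ₗ[ℂ] (Fin m → ℂ) →ₗ[ℂ] ℂ
  self : ∀ u, form u u = 0
  /-- The Hamiltonian vectors of the coordinate functions. -/
  dual : Fin m → Fin m → ℂ
  form_dual : ∀ u a, form u (dual a) = u a

namespace SymplecticForm

variable {m : ℕ} (S : SymplecticForm m)

theorem swap (u v : Fin m → ℂ) : S.form u v = -S.form v u := by
  have h := S.self (u + v)
  simp only [map_add, LinearMap.add_apply, S.self, zero_add, add_zero] at h
  exact eq_neg_of_add_eq_zero_right h

/-- The field `form_dual` encodes nondegeneracy: pairing with `dual a` reads off the a-th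
coordinate. -/
theorem eq_of_forall {u v : Fin m → ℂ} (h : ∀ w, S.form w u = S.form w v) : u = v := by
  funext a
  rw [← S.form_dual u a, ← S.form_dual v a, S.swap u, S.swap v, h]

/-- The standard basis. -/
abbrev e (a : Fin m) : Fin m → ℂ := Pi.single a 1

theorem sum_smul_e (z : Fin m → ℂ) : ∑ a, z a • e a = z := (pi_eq_sum_univ' z).symm

theorem sum_form_dual (v : Fin m → ℂ) : ∑ a, S.form (e a) v • S.dual a = v :=
  S.eq_of_forall fun w => by
    simp only [map_sum, map_smul, S.form_dual, smul_eq_mul]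
    conv_rhs => rw [← sum_smul_e w]
    simp only [map_sum, map_smul, LinearMap.sum_apply, LinearMap.smul_apply, smul_eq_mul]
    exact Finset.sum_congr rfl fun a _ => mul_comm _ _

theorem sum_form_dual' (v : Fin m → ℂ) : ∑ a, S.form v (e a) • S.dual a = -v := by
  simp only [S.swap v, neg_smul, Finset.sum_neg_distrib, S.sum_form_dual]

/-- Multiplication by (twice) the dual bivector. -/
def L : ExteriorAlgebra ℂ (Fin m → ℂ) →ₗ[ℂ] ExteriorAlgebra ℂ (Fin m → ℂ) :=
  ∑ a, wedge (S.dual a) ∘ₗ wedge (e a)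

/-- Contraction with (twice) the symplectic form. -/
def Λ : ExteriorAlgebra ℂ (Fin m → ℂ) →ₗ[ℂ] ExteriorAlgebra ℂ (Fin m → ℂ) :=
  ∑ a, contract (LinearMap.proj a) ∘ₗ contract (S.form (e a))

theorem L_apply (X : ExteriorAlgebra ℂ (Fin m → ℂ)) :
    S.L X = ∑ a, ι ℂ (S.dual a) * (ι ℂ (e a) * X) := by
  simp [L, wedge_apply]

theorem Λ_apply (X : ExteriorAlgebra ℂ (Fin m → ℂ)) :
    S.Λ X = ∑ a, contract (LinearMap.proj a) (contract (S.form (e a)) X) := by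
  simp [Λ]

theorem L_mem {q : ℕ} {X : ExteriorAlgebra ℂ (Fin m → ℂ)} (hX : X ∈ ⋀[ℂ]^q (Fin m → ℂ)) :
    S.L X ∈ ⋀[ℂ]^(q + 2) (Fin m → ℂ) := by
  rw [L_apply]
  exact Submodule.sum_mem _ fun a _ => ι_mul_mem _ (ι_mul_mem _ hX)

theorem Λ_mem {q : ℕ} {X : ExteriorAlgebra ℂ (Fin m → ℂ)} (hX : X ∈ ⋀[ℂ]^(q + 2) (Fin m → ℂ)) :
    S.Λ X ∈ ⋀[ℂ]^q (Fin m → ℂ) := by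
  rw [Λ_apply]
  exact Submodule.sum_mem _ fun a _ => contract_mem_pred _ (contract_mem_pred _ hX)

theorem Λ_eq_zero {X : ExteriorAlgebra ℂ (Fin m → ℂ)} (hX : X ∈ ⋀[ℂ]^1 (Fin m → ℂ)) :
    S.Λ X = 0 := by
  rw [Λ_apply]
  exact Finset.sum_eq_zero fun a _ => contract_eq_zero _ (contract_mem_pred _ hX)

theorem ι_mul_L (z : Fin m → ℂ) (X : ExteriorAlgebra ℂ (Fin m → ℂ)) :
    ι ℂ z * S.L X = S.L (ι ℂ z * X) := by
  simp only [L_apply, Finset.mul_sum]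
  refine Finset.sum_congr rfl fun a _ => ?_
  rw [ι_mul_swap z, ι_mul_swap z, mul_neg, neg_neg]

theorem contract_Λ (θ : (Fin m → ℂ) →ₗ[ℂ] ℂ) (X : ExteriorAlgebra ℂ (Fin m → ℂ)) :
    contract θ (S.Λ X) = S.Λ (contract θ X) := by
  simp only [Λ_apply, map_sum]
  refine Finset.sum_congr rfl fun a _ => ?_
  rw [contract_comm θ, contract_comm θ, map_neg, neg_neg]

/-- The contraction may hit either factor of the bivector, and each choice contributes one z ∧ X
after summation, the second because two signs cancel. -/
theorem contract_L (z : Fin m → ℂ) (X : ExteriorAlgebra ℂ (Fin m → ℂ)) :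
    contract (S.form z) (S.L X) = (2 : ℂ) • (ι ℂ z * X) + S.L (contract (S.form z) X) := by
  have h1 : ∀ a, contract (S.form z) (ι ℂ (S.dual a) * (ι ℂ (e a) * X)) =
      ι ℂ (z a • e a) * X - ι ℂ (S.form z (e a) • S.dual a) * X +
        ι ℂ (S.dual a) * (ι ℂ (e a) * contract (S.form z) X) := fun a => by
    rw [contract_ι_mul, contract_ι_mul, S.form_dual, map_smul, map_smul, mul_sub]
    simp only [smul_mul_assoc, mul_smul_comm]
    abel
  simp only [L_apply, map_sum, h1, Finset.sum_add_distrib, Finset.sum_sub_distrib]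
  simp only [← Finset.sum_mul, ← map_sum, sum_smul_e, S.sum_form_dual', map_neg, neg_mul, two_smul]
  abel

theorem sum_smul_form (z : Fin m → ℂ) : ∑ a, z a • S.form (e a) = S.form z := by
  conv_rhs => rw [← sum_smul_e z]
  simp only [map_sum, map_smul]

theorem sum_form_smul_proj (z : Fin m → ℂ) :
    ∑ a, S.form (e a) z • (LinearMap.proj a : (Fin m → ℂ) →ₗ[ℂ] ℂ) = -S.form z := by
  ext u
  simp [S.swap z, Pi.single_apply]

/-- Adjoint counterpart of `contract_L`. It shows that Λ P is killed by z whenever P is killed both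
by z and by contraction with ω(z, ·), which feeds the recursion. -/
theorem Λ_ι_mul (z : Fin m → ℂ) (X : ExteriorAlgebra ℂ (Fin m → ℂ)) :
    S.Λ (ι ℂ z * X) = ι ℂ z * S.Λ X - (2 : ℂ) • contract (S.form z) X := by
  have h1 : ∀ a, contract (LinearMap.proj a) (contract (S.form (e a)) (ι ℂ z * X)) =
      contract (S.form (e a) z • (LinearMap.proj a : (Fin m → ℂ) →ₗ[ℂ] ℂ)) X -
      contract (z a • S.form (e a)) X +
      ι ℂ z * contract (LinearMap.proj a) (contract (S.form (e a)) X) := fun a => by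
    rw [contract_ι_mul, map_sub, map_smul, contract_ι_mul, contract_smul, contract_smul,
      LinearMap.proj_apply]
    abel
  simp only [Λ_apply, h1, Finset.sum_add_distrib, Finset.sum_sub_distrib, ← contract_sum,
    S.sum_smul_form, S.sum_form_smul_proj, ← Finset.mul_sum]
  rw [← neg_one_smul ℂ (S.form z), contract_smul]
  module

/-- Contractions and multiplications anticommute up to a scalar; these scalars add up to the
dimension m, and the reversed products add up to the degree q. -/
theorem sum_contract_ι_mul {q : ℕ} {X : ExteriorAlgebra ℂ (Fin m → ℂ)}
    (hX : X ∈ ⋀[ℂ]^q (Fin m → ℂ)) :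
    ∑ a, contract (LinearMap.proj a) (ι ℂ (e a) * X) = ((m : ℂ) - q) • X := by
  have h := sum_ι_mul_contract (fun a : Fin m => e a) (fun a => LinearMap.proj a)
    (fun u => sum_smul_e u) hX
  simp only [contract_ι_mul, Finset.sum_sub_distrib, h]
  simp [sub_smul, Nat.cast_smul_eq_nsmul]

end SymplecticForm

end

end ContactCP

/-! ### Homogeneous polyvector fields on cones, divergence and exterior derivative -/

namespace ContactCP

noncomputable section

open ExteriorAlgebra (ι)

/-- Open subsets of `ℂ^m ∖ 0` which are stable under nonzero scalars. -/
structure IsOpenCone {m : ℕ} (U : Set (Fin m → ℂ)) : Prop where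
  isOpen : IsOpen U
  smul_mem : ∀ z ∈ U, ∀ a : ℂ, a ≠ 0 → a • z ∈ U
  ne_zero : ∀ z ∈ U, z ≠ 0

/-- Holomorphic polyvector fields of degree `q` on a cone, with coefficients which are homogeneous of
degree `d`. -/
structure IsPolyField {m : ℕ} (U : Set (Fin m → ℂ)) (d : ℤ) (q : ℕ)
    (P : (Fin m → ℂ) → ExteriorAlgebra ℂ (Fin m → ℂ)) : Prop where
  weakDiffAt : ∀ z ∈ U, WeakDiffAt P z
  smul : ∀ z ∈ U, ∀ a : ℂ, a ≠ 0 → P (a • z) = a ^ d • P z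
  mem : ∀ z ∈ U, P z ∈ ⋀[ℂ]^q (Fin m → ℂ)

section

variable {m : ℕ} {U : Set (Fin m → ℂ)} {d : ℤ} {q : ℕ}
  {P Q : (Fin m → ℂ) → ExteriorAlgebra ℂ (Fin m → ℂ)}

namespace IsPolyField

theorem mono {U' : Set (Fin m → ℂ)} (h : U' ⊆ U) (hP : IsPolyField U d q P) :
    IsPolyField U' d q P :=
  ⟨fun z hz => hP.1 z (h hz), fun z hz => hP.2 z (h hz), fun z hz => hP.3 z (h hz)⟩

theorem linear {q' : ℕ} (T : ExteriorAlgebra ℂ (Fin m → ℂ) →ₗ[ℂ] ExteriorAlgebra ℂ (Fin m → ℂ))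
    (hT : ∀ X ∈ ⋀[ℂ]^q (Fin m → ℂ), T X ∈ ⋀[ℂ]^q' (Fin m → ℂ)) (hP : IsPolyField U d q P) :
    IsPolyField U d q' fun z => T (P z) :=
  ⟨fun z hz => (hP.1 z hz).linear T, fun z hz a ha => by rw [hP.2 z hz a ha, map_smul],
    fun z hz => hT _ (hP.3 z hz)⟩

theorem add (hP : IsPolyField U d q P) (hQ : IsPolyField U d q Q) :
    IsPolyField U d q fun z => P z + Q z :=
  ⟨fun z hz => (hP.1 z hz).add (hQ.1 z hz),
    fun z hz a ha => by rw [hP.2 z hz a ha, hQ.2 z hz a ha, smul_add],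
    fun z hz => Submodule.add_mem _ (hP.3 z hz) (hQ.3 z hz)⟩

theorem const_smul (c : ℂ) (hP : IsPolyField U d q P) : IsPolyField U d q fun z => c • P z :=
  hP.linear (LinearMap.lsmul ℂ _ c) fun _ hX => Submodule.smul_mem _ c hX

theorem sub (hP : IsPolyField U d q P) (hQ : IsPolyField U d q Q) :
    IsPolyField U d q fun z => P z - Q z := by
  simpa [sub_eq_add_neg] using hP.add (hQ.const_smul (-1))

theorem sum {I : Type*} [Fintype I] {P : I → (Fin m → ℂ) → ExteriorAlgebra ℂ (Fin m → ℂ)}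
    (hP : ∀ i, IsPolyField U d q (P i)) : IsPolyField U d q fun z => ∑ i, P i z :=
  ⟨fun z hz => WeakDiffAt.sum _ fun i _ => (hP i).1 z hz,
    fun z hz a ha => by simp only [(hP _).2 z hz a ha, Finset.smul_sum],
    fun z hz => Submodule.sum_mem _ fun i _ => (hP i).3 z hz⟩

theorem pd (hU : IsOpenCone U) (hP : IsPolyField U d q P) (v : Fin m → ℂ) :
    IsPolyField U (d - 1) q fun z => pd P z v where
  weakDiffAt z hz := WeakDiffAt.pd hU.1 hP.1 v hz
  smul z hz a ha := pd_smul_point d ha (hP.1 z hz) (hP.1 _ (hU.2 z hz a ha))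
    (by filter_upwards [hU.1.mem_nhds hz] with y hy using hP.2 y hy a ha) v
  mem z hz := pd_mem (hP.1 z hz) _
    (by filter_upwards [hU.1.mem_nhds hz] with y hy using hP.3 y hy) v

theorem euler (hP : IsPolyField U d q P) {z : Fin m → ℂ} (hz : z ∈ U) :
    ContactCP.pd P z z = (d : ℂ) • P z :=
  pd_euler (hP.1 z hz) d (hP.2 z hz)

end IsPolyField

/-- The divergence of a polyvector field. -/
def divergence (P : (Fin m → ℂ) → ExteriorAlgebra ℂ (Fin m → ℂ)) (z : Fin m → ℂ) :
    ExteriorAlgebra ℂ (Fin m → ℂ) :=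
  ∑ a, contract (LinearMap.proj a) (pd P z (SymplecticForm.e a))

theorem divergence_congr {z : Fin m → ℂ} (h : P =ᶠ[nhds z] Q) :
    divergence P z = divergence Q z := by
  simp only [divergence, pd_congr h]

theorem divergence_add {z : Fin m → ℂ} (hP : WeakDiffAt P z) (hQ : WeakDiffAt Q z) :
    divergence (fun y => P y + Q y) z = divergence P z + divergence Q z := by
  simp only [divergence, pd_add hP hQ, map_add, Finset.sum_add_distrib]

theorem divergence_const_smul (c : ℂ) {z : Fin m → ℂ} (hP : WeakDiffAt P z) :
    divergence (fun y => c • P y) z = c • divergence P z := by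
  simp only [divergence, pd_const_smul c hP, map_smul, Finset.smul_sum]

theorem IsPolyField.divergence (hU : IsOpenCone U) (hP : IsPolyField U d (q + 1) P) :
    IsPolyField U (d - 1) q (divergence P) :=
  IsPolyField.sum fun _ => (hP.pd hU _).linear _ fun _ hX => contract_mem_pred _ hX

/-- Differentiating the factor z gives m - q, and the derivative of Q along z gives d by Euler's
relation. So the divergence recovers Q from z ∧ Q up to a scalar and modulo z. -/
theorem divergence_ι_mul {z : Fin m → ℂ} (hz : z ∈ U) (hQ : IsPolyField U d q Q) :
    divergence (fun y => ι ℂ y * Q y) z =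
      ((m : ℂ) - q + d) • Q z - ι ℂ z * divergence Q z := by
  have h1 : ∀ v, ContactCP.pd (fun y => ι ℂ y * Q y) z v =
      ι ℂ v * Q z + ι ℂ z * ContactCP.pd Q z v := pd_bilin wedge (hQ.1 z hz)
  simp only [divergence, h1, map_add, Finset.sum_add_distrib,
    SymplecticForm.sum_contract_ι_mul (hQ.3 z hz)]
  simp only [contract_ι_mul, Finset.sum_sub_distrib, ← Finset.mul_sum, LinearMap.proj_apply]
  rw [← pd_eq_sum, hQ.euler hz]
  module

namespace SymplecticForm

variable (S : SymplecticForm m)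

/-- The exterior derivative, transported to polyvector fields by the symplectic form. -/
def D (P : (Fin m → ℂ) → ExteriorAlgebra ℂ (Fin m → ℂ)) (z : Fin m → ℂ) :
    ExteriorAlgebra ℂ (Fin m → ℂ) :=
  ∑ a, ι ℂ (S.dual a) * pd P z (e a)

theorem D_congr {z : Fin m → ℂ} (h : P =ᶠ[nhds z] Q) : S.D P z = S.D Q z := by
  simp only [D, pd_congr h]

theorem D_add {z : Fin m → ℂ} (hP : WeakDiffAt P z) (hQ : WeakDiffAt Q z) :
    S.D (fun y => P y + Q y) z = S.D P z + S.D Q z := by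
  simp only [D, pd_add hP hQ, mul_add, Finset.sum_add_distrib]

theorem D_const_smul (c : ℂ) {z : Fin m → ℂ} (hP : WeakDiffAt P z) :
    S.D (fun y => c • P y) z = c • S.D P z := by
  simp only [D, pd_const_smul c hP, mul_smul_comm, Finset.smul_sum]

theorem isPolyField_D (hU : IsOpenCone U) (hP : IsPolyField U d q P) :
    IsPolyField U (d - 1) (q + 1) (S.D P) :=
  IsPolyField.sum fun a => (hP.pd hU _).linear (wedge (S.dual a)) fun _ hX => ι_mul_mem _ hX

/-- The term L (Q z), from differentiating the factor z, measures how far D is from being well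
defined modulo z. -/
theorem D_ι_mul {z : Fin m → ℂ} (hQ : WeakDiffAt Q z) :
    S.D (fun y => ι ℂ y * Q y) z = S.L (Q z) - ι ℂ z * S.D Q z := by
  have h1 : ∀ v, pd (fun y => ι ℂ y * Q y) z v = ι ℂ v * Q z + ι ℂ z * pd Q z v :=
    pd_bilin wedge hQ
  simp only [D, h1, mul_add, Finset.sum_add_distrib, L_apply, Finset.mul_sum, sub_eq_add_neg]
  congr 1
  rw [← Finset.sum_neg_distrib]
  exact Finset.sum_congr rfl fun a _ => ι_mul_swap _ _ _

/-- The derivative of the contraction with the Euler field. -/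
theorem contract_pd (hU : IsOpen U) (hP : ∀ z ∈ U, WeakDiffAt P z)
    (h : ∀ z ∈ U, contract (S.form z) (P z) = 0) {z : Fin m → ℂ} (hz : z ∈ U) (v : Fin m → ℂ) :
    contract (S.form z) (pd P z v) = -contract (S.form v) (P z) := by
  have h1 : pd (fun y => contract (S.form y) (P y)) z v =
      contract (S.form v) (P z) + contract (S.form z) (pd P z v) :=
    pd_bilin (contractHom ∘ₗ S.form) (hP z hz) v
  have h2 : (fun y => contract (S.form y) (P y)) =ᶠ[nhds z] fun y => (0 : ℂ) • P y := by
    filter_upwards [hU.mem_nhds hz] with y hy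
    rw [h y hy, zero_smul]
  rw [pd_congr h2, pd_const_smul _ (hP z hz), zero_smul] at h1
  exact eq_neg_of_add_eq_zero_right h1.symm

/-- Cartan's formula for the Euler field on a form which that field annihilates: d is the degree of
the coefficients, and q comes from differentiating the constraint. -/
theorem contract_D (hU : IsOpen U) (hP : IsPolyField U d q P)
    (h : ∀ z ∈ U, contract (S.form z) (P z) = 0) {z : Fin m → ℂ} (hz : z ∈ U) :
    contract (S.form z) (S.D P z) = ((d : ℂ) + q) • P z := by
  simp only [D, map_sum, contract_ι_mul, S.contract_pd hU hP.1 h hz, S.form_dual, mul_neg,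
    sub_neg_eq_add, Finset.sum_add_distrib]
  rw [← pd_eq_sum, hP.euler hz,
    sum_ι_mul_contract S.dual (fun a => S.form (e a)) S.sum_form_dual (hP.3 z hz), add_smul]

/-- Differentiating the constraint replaces z by the basis vector with a sign, which cancels the
sign from exchanging the two contractions. -/
theorem contract_divergence (hU : IsOpen U) (hP : ∀ z ∈ U, WeakDiffAt P z)
    (h : ∀ z ∈ U, contract (S.form z) (P z) = 0) {z : Fin m → ℂ} (hz : z ∈ U) :
    contract (S.form z) (divergence P z) = S.Λ (P z) := by
  simp only [divergence, map_sum, Λ_apply]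
  refine Finset.sum_congr rfl fun a _ => ?_
  rw [contract_comm, S.contract_pd hU hP h hz, map_neg, neg_neg]

/-! ### The splitting operator on the cone -/

/-- The leading part of the splitting operator. -/
def T (d : ℤ) (q : ℕ) (P : (Fin m → ℂ) → ExteriorAlgebra ℂ (Fin m → ℂ)) (z : Fin m → ℂ) :
    ExteriorAlgebra ℂ (Fin m → ℂ) :=
  S.D P z - ((m : ℂ) - q + d)⁻¹ • S.L (divergence P z)

theorem isPolyField_T (hU : IsOpenCone U) (hP : IsPolyField U d (q + 1) P) :
    IsPolyField U (d - 1) (q + 2) (S.T d (q + 1) P) :=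
  (S.isPolyField_D hU hP).sub
    (((hP.divergence hU).linear S.L fun _ hX => S.L_mem hX).const_smul _)

/-- Multiplication by z removes the term 2 z ∧ div P from `contract_L`. The remaining term with Λ P
is the error that the recursion in `splitOp` cancels. -/
theorem ι_mul_contract_T (hU : IsOpen U) (hP : IsPolyField U d q P)
    (h : ∀ z ∈ U, contract (S.form z) (P z) = 0) {z : Fin m → ℂ} (hz : z ∈ U) :
    ι ℂ z * contract (S.form z) (S.T d q P z) =
      ((d : ℂ) + q) • (ι ℂ z * P z) - ((m : ℂ) - q + d)⁻¹ • S.L (ι ℂ z * S.Λ (P z)) := by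
  rw [T, map_sub, map_smul, contract_L, S.contract_divergence hU hP.1 h hz,
    S.contract_D hU hP h hz]
  simp only [mul_sub, mul_add, mul_smul_comm, ι_mul_self_mul, smul_zero, zero_add, ι_mul_L]

/-- Division by z through contraction with dz_i / z_i, which takes the value 1 on z. It is only
local, since z_i may vanish elsewhere on the cone. -/
theorem _root_.ContactCP.IsPolyField.exists_eq_ι_mul (hP : IsPolyField U d (q + 1) P)
    (hU : IsOpenCone U)
    (h' : ∀ z ∈ U, ι ℂ z * P z = 0) {z : Fin m → ℂ} (hz : z ∈ U) : ∃ Q U', z ∈ U' ∧ IsOpenCone U' ∧ IsPolyField U' (d - 1) q Q ∧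
      ∀ y ∈ U', P y = ι ℂ y * Q y := by
  obtain ⟨i, hi⟩ := Function.ne_iff.1 (hU.ne_zero z hz)
  refine ⟨fun y => (y i)⁻¹ • contract (LinearMap.proj i) (P y), U ∩ {y | y i ≠ 0}, ⟨hz, hi⟩,
    ⟨hU.1.inter (isOpen_ne_fun (continuous_apply i) continuous_const),
      fun y hy a ha => ⟨hU.2 y hy.1 a ha, mul_ne_zero ha hy.2⟩, fun y hy => hU.3 y hy.1⟩,
    ⟨fun y hy => WeakDiffAt.smul ((differentiableAt_apply i y).fun_inv hy.2)
      ((hP.1 y hy.1).linear _), fun y hy a ha => ?_,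
      fun y hy => Submodule.smul_mem _ _ (contract_mem_pred _ (hP.3 y hy.1))⟩, fun y hy => ?_⟩
  · rw [hP.2 y hy.1 a ha, map_smul, smul_smul, smul_smul, Pi.smul_apply, smul_eq_mul,
      zpow_sub_one₀ ha]
    congr 1
    rw [mul_inv]
    ring
  · have hy2 : y i ≠ 0 := hy.2
    have h1 : ((y i)⁻¹ • (LinearMap.proj i : (Fin m → ℂ) →ₗ[ℂ] ℂ)) y = 1 := by
      simp [hy2]
    conv_lhs => rw [eq_ι_mul_contract h1 (h' y hy.1), contract_smul]

/-- Write P = z ∧ Q locally. Modulo z, D contributes L Q and the divergence contributes c Q, so the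
coefficient c⁻¹ in `T` makes them cancel. -/
theorem ι_mul_T (hU : IsOpenCone U) (hP : IsPolyField U d (q + 1) P)
    (hc : (m : ℂ) - (q + 1 : ℕ) + d ≠ 0) (h' : ∀ z ∈ U, ι ℂ z * P z = 0)
    {z : Fin m → ℂ} (hz : z ∈ U) : ι ℂ z * S.T d (q + 1) P z = 0 := by
  obtain ⟨Q, U', hz', hU', hQ, hPQ⟩ := hP.exists_eq_ι_mul hU h' hz
  have he : P =ᶠ[nhds z] fun y => ι ℂ y * Q y := by
    filter_upwards [hU'.1.mem_nhds hz'] with y hy using hPQ y hy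
  -- Q has both its degree and its coefficient degree lower by one than P, and the two shifts
  -- cancel.
  have hc' : (m : ℂ) - q + (d - 1 : ℤ) = (m : ℂ) - (q + 1 : ℕ) + d := by push_cast; ring
  rw [T, S.D_congr he, divergence_congr he, S.D_ι_mul (hQ.1 z hz'), divergence_ι_mul hz' hQ,
    hc', map_sub, map_smul, smul_sub, smul_smul, inv_mul_cancel₀ hc, one_smul, ← S.ι_mul_L]
  simp only [mul_sub, mul_smul_comm, ι_mul_self_mul]
  simp

/-- The operator which splits the contraction with the contact form, on polyvector fields of
degree `q` with coefficients of degree `d`. -/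
def splitOp (d : ℤ) : ℕ → ((Fin m → ℂ) → ExteriorAlgebra ℂ (Fin m → ℂ)) →
    (Fin m → ℂ) → ExteriorAlgebra ℂ (Fin m → ℂ)
  -- Scalars have no divergence, so D alone suffices and no condition on m + d arises. In degree 1
  -- the recursion stops because Λ P = 0.
  | 0, P, z => (d : ℂ)⁻¹ • S.D P z
  | 1, P, z => ((d : ℂ) + (1 : ℕ))⁻¹ • S.T d 1 P z
  -- If Y splits Λ P modulo z, then contracting L Y gives L Λ P modulo z by `contract_L`, which
  -- cancels the error of `T`. Since Λ has constant coefficients, d is unchanged.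
  | q + 2, P, z => ((d : ℂ) + (q + 2 : ℕ))⁻¹ • (S.T d (q + 2) P z +
      ((m : ℂ) - (q + 2 : ℕ) + d)⁻¹ • S.L (splitOp d q (fun y => S.Λ (P y)) z))

theorem isPolyField_splitOp (hU : IsOpenCone U) (hP : IsPolyField U d q P) :
    IsPolyField U (d - 1) (q + 1) (S.splitOp d q P) := by
  induction q using Nat.twoStepInduction generalizing P with
  | zero => exact (S.isPolyField_D hU hP).const_smul _
  | one => exact (S.isPolyField_T hU hP).const_smul _
  | more q ih _ =>
    exact ((S.isPolyField_T hU hP).add (((ih (hP.linear S.Λ fun _ hX => S.Λ_mem hX)).linear S.L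
      fun _ hX => S.L_mem hX).const_smul _)).const_smul _

theorem T_congr {z : Fin m → ℂ} (h : P =ᶠ[nhds z] Q) : S.T d q P z = S.T d q Q z := by
  simp only [T, S.D_congr h, divergence_congr h]

theorem T_add {z : Fin m → ℂ} (hP : WeakDiffAt P z) (hQ : WeakDiffAt Q z) :
    S.T d q (fun y => P y + Q y) z = S.T d q P z + S.T d q Q z := by
  simp only [T, S.D_add hP hQ, divergence_add hP hQ, map_add, smul_add]
  abel

theorem T_const_smul (c : ℂ) {z : Fin m → ℂ} (hP : WeakDiffAt P z) :
    S.T d q (fun y => c • P y) z = c • S.T d q P z := by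
  simp only [T, S.D_const_smul c hP, divergence_const_smul c hP, map_smul, smul_sub]
  rw [smul_comm c]

theorem splitOp_congr {z : Fin m → ℂ} (h : P =ᶠ[nhds z] Q) :
    S.splitOp d q P z = S.splitOp d q Q z := by
  induction q using Nat.twoStepInduction generalizing P Q with
  | zero => simp only [splitOp, S.D_congr h]
  | one => simp only [splitOp, S.T_congr h]
  | more q ih _ =>
    have h1 := ih (P := fun y => S.Λ (P y)) (Q := fun y => S.Λ (Q y)) (h.fun_comp S.Λ)
    simp only [splitOp, S.T_congr h, h1]

theorem splitOp_add {z : Fin m → ℂ} (hP : WeakDiffAt P z) (hQ : WeakDiffAt Q z) :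
    S.splitOp d q (fun y => P y + Q y) z = S.splitOp d q P z + S.splitOp d q Q z := by
  induction q using Nat.twoStepInduction generalizing P Q with
  | zero => simp only [splitOp, S.D_add hP hQ, smul_add]
  | one => simp only [splitOp, S.T_add hP hQ, smul_add]
  | more q ih _ =>
    simp only [splitOp, S.T_add hP hQ, map_add, ih (hP.linear S.Λ) (hQ.linear S.Λ), smul_add]
    abel

theorem splitOp_const_smul (c : ℂ) {z : Fin m → ℂ} (hP : WeakDiffAt P z) :
    S.splitOp d q (fun y => c • P y) z = c • S.splitOp d q P z := by
  induction q using Nat.twoStepInduction generalizing P with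
  | zero => simp only [splitOp, S.D_const_smul c hP, smul_comm c]
  | one => simp only [splitOp, S.T_const_smul c hP, smul_comm c]
  | more q ih _ =>
    simp only [splitOp, S.T_const_smul c hP, map_smul, ih (hP.linear S.Λ), smul_add,
      smul_comm c]

/-- The denominators in the splitting operator do not vanish. -/
def IsRegular (m : ℕ) (d : ℤ) (q : ℕ) : Prop :=
  -- At depth j the degree is q - 2j, and the denominators are d + (q - 2j) and m - (q - 2j) + d.
  -- The second occurs only in positive degree, whence 2j + 1 ≤ q.
  (∀ j : ℕ, 2 * j ≤ q → d + q - 2 * j ≠ 0) ∧ ∀ j : ℕ, 2 * j + 1 ≤ q → (m : ℤ) - q + d + 2 * j ≠ 0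

theorem IsRegular.pred {m : ℕ} {d : ℤ} {q : ℕ} (h : IsRegular m d (q + 2)) : IsRegular m d q := by
  refine ⟨fun j hj h0 => h.1 (j + 1) (by omega) ?_, fun j hj h0 => h.2 (j + 1) (by omega) ?_⟩ <;>
  · push_cast
    linarith

theorem IsRegular.add_ne_zero {m : ℕ} {d : ℤ} {q : ℕ} (h : IsRegular m d q) : (d : ℂ) + q ≠ 0 := by
  have := h.1 0 (by omega)
  norm_cast
  simpa using this

theorem IsRegular.sub_add_ne_zero {m : ℕ} {d : ℤ} {q : ℕ} (h : IsRegular m d (q + 1)) :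
    (m : ℂ) - (q + 1 : ℕ) + d ≠ 0 := by
  have h1 := h.2 0 (by omega)
  intro h0
  refine h1 ?_
  have h2 : (((m : ℤ) - (q + 1 : ℕ) + d : ℤ) : ℂ) = 0 := by push_cast at h0 ⊢; exact h0
  simpa using Int.cast_eq_zero.1 h2

/-- Induction in steps of two: the hypothesis for Λ P, which is again horizontal by `contract_Λ`,
supplies the term missing from `ι_mul_contract_T`. -/
theorem ι_mul_contract_splitOp (hU : IsOpenCone U) (hd : IsRegular m d q) (hP : IsPolyField U d q P)
    (h : ∀ z ∈ U, contract (S.form z) (P z) = 0) {z : Fin m → ℂ} (hz : z ∈ U) :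
    ι ℂ z * contract (S.form z) (S.splitOp d q P z) = ι ℂ z * P z := by
  induction q using Nat.twoStepInduction generalizing P with
  | zero =>
    have h0 := hd.add_ne_zero
    simp only [splitOp, map_smul, S.contract_D hU.1 hP h hz]
    simp only [Nat.cast_zero, add_zero] at h0 ⊢
    rw [smul_smul, inv_mul_cancel₀ h0, one_smul]
  | one =>
    simp only [splitOp, map_smul, mul_smul_comm]
    rw [S.ι_mul_contract_T hU.1 hP h hz, S.Λ_eq_zero (hP.3 z hz), mul_zero, map_zero, smul_zero,
      sub_zero, smul_smul, inv_mul_cancel₀ hd.add_ne_zero, one_smul]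
  | more q ih _ =>
    have h1 := ih hd.pred (hP.linear S.Λ fun _ hX => S.Λ_mem hX)
      fun y hy => by rw [contract_Λ, h y hy, map_zero]
    simp only [splitOp, map_smul, mul_smul_comm, map_add, mul_add, contract_L,
      ι_mul_self_mul, smul_zero, zero_add]
    rw [S.ι_mul_contract_T hU.1 hP h hz, ι_mul_L, h1, sub_add_cancel, smul_smul,
      inv_mul_cancel₀ hd.add_ne_zero, one_smul]

/-- Meant for the difference P of two lifts of one section: the output then vanishes modulo z, so
the operator descends to projective space. -/
theorem ι_mul_splitOp (hU : IsOpenCone U) (hd : IsRegular m d q) (hP : IsPolyField U d q P)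
    (h : ∀ z ∈ U, contract (S.form z) (P z) = 0) (h' : ∀ z ∈ U, ι ℂ z * P z = 0)
    {z : Fin m → ℂ} (hz : z ∈ U) : ι ℂ z * S.splitOp d q P z = 0 := by
  induction q using Nat.twoStepInduction generalizing P with
  | zero =>
    -- In degree 0, a function killed by the nonzero vector z is zero.
    have h0 : P =ᶠ[nhds z] fun y => (0 : ℂ) • P y := by
      filter_upwards [hU.1.mem_nhds hz] with y hy
      obtain ⟨i, hi⟩ := Function.ne_iff.1 (hU.ne_zero y hy)
      have h1 : ((y i)⁻¹ • (LinearMap.proj i : (Fin m → ℂ) →ₗ[ℂ] ℂ)) y = 1 := by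
        simpa using inv_mul_cancel₀ hi
      rw [zero_smul, eq_ι_mul_contract h1 (h' y hy), contract_eq_zero _ (hP.3 y hy), mul_zero]
    rw [splitOp, S.D_congr h0, S.D_const_smul 0 (hP.1 z hz), zero_smul, smul_zero, mul_zero]
  | one =>
    simp only [splitOp, mul_smul_comm]
    rw [S.ι_mul_T hU hP hd.sub_add_ne_zero h' hz, smul_zero]
  | more q ih _ =>
    -- `Λ_ι_mul` shows that Λ P inherits both constraints.
    have h1 := ih hd.pred (hP.linear S.Λ fun _ hX => S.Λ_mem hX)
      (fun y hy => by rw [contract_Λ, h y hy, map_zero]) fun y hy => by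
        have := S.Λ_ι_mul y (P y)
        rw [h' y hy, h y hy, map_zero, smul_zero, sub_zero] at this
        exact this.symm
    simp only [splitOp, mul_smul_comm, mul_add, ι_mul_L, h1, map_zero, smul_zero, add_zero]
    rw [S.ι_mul_T hU hP hd.sub_add_ne_zero h' hz, smul_zero]

end SymplecticForm

end

end

end ContactCP

/-! ### The symplectic form of the contact structure -/

namespace ContactCP

noncomputable section

open ExteriorAlgebra (ι)

/-- The symplectic form on `ℂ^(2n+2)` given by the contact form in homogeneous coordinates. -/
def contactSymplectic (n : ℕ) : SymplecticForm (2 * n + 1 + 1) where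
  form :=
    { toFun := contactHom n
      map_add' := fun u v => by
        simp only [contactHom, Pi.add_apply, add_smul, ← Finset.sum_add_distrib]
        exact Finset.sum_congr rfl fun j _ => by module
      map_smul' := fun a u => contactHom_smul n a u }
  self := contactHom_self n
  dual a := if h : (a : ℕ) % 2 = 0 then Pi.single (⟨(a : ℕ) + 1, by omega⟩ : Fin (2 * n + 1 + 1)) 1
    else -Pi.single (⟨(a : ℕ) - 1, by omega⟩ : Fin (2 * n + 1 + 1)) 1
  form_dual u a := by
    simp only [LinearMap.coe_mk, AddHom.coe_mk, contactHom, LinearMap.sum_apply,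
      LinearMap.sub_apply, LinearMap.smul_apply, LinearMap.proj_apply, smul_eq_mul]
    -- Only the symplectic pair containing the index a contributes.
    rw [Finset.sum_eq_single ⟨(a : ℕ) / 2, by omega⟩ ?_ (by simp)]
    · split_ifs with h
      · have h1 : (⟨2 * ((a : ℕ) / 2), by omega⟩ : Fin (2 * n + 1 + 1)) = a :=
          Fin.ext (by simp only; omega)
        simp only [h1, Pi.single_apply, Fin.ext_iff]
        rw [if_pos (by omega), if_neg (by omega)]
        simp
      · have h1 : (⟨2 * ((a : ℕ) / 2) + 1, by omega⟩ : Fin (2 * n + 1 + 1)) = a :=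
          Fin.ext (by simp only; omega)
        simp only [h1, Pi.neg_apply, Pi.single_apply, Fin.ext_iff]
        rw [if_neg (by omega), if_pos (by omega)]
        simp
    · intro j _ hj
      have hj' : (j : ℕ) ≠ (a : ℕ) / 2 := fun h => hj (Fin.ext h)
      split_ifs with h
      · simp only [Pi.single_apply, Fin.ext_iff]
        rw [if_neg (by omega), if_neg (by omega)]
        simp
      · simp only [Pi.neg_apply, Pi.single_apply, Fin.ext_iff]
        rw [if_neg (by omega), if_neg (by omega)]
        simp

theorem contactSymplectic_form (n : ℕ) (z : Vec (2 * n + 1)) :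
    (contactSymplectic n).form z = contactHom n z := rfl

section

variable {N : ℕ}

/-! ### Lifts of tangent vectors -/

/-- The lift of tangent vectors at `x` to vectors at the representative `z`. -/
def tangentLift {x : CP N} (z : Line x) : T x →ₗ[ℂ] Vec N :=
  (mfderiv 𝓘(ℂ, Fin N → ℂ) 𝓘(ℂ, Vec N) (liftThrough x z.1) x : T x →L[ℂ] Vec N).toLinearMap

/-- The lift of tangent vectors in the chart around `x₀`, modulo the radial direction. -/
theorem tangentLift_apply {x : CP N} (z : Line x) (x₀ : CP N)
    (hx : x ∈ (chartAt (Fin N → ℂ) x₀).source) (v : T x) :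
    ∃ c : ℂ, tangentLift z v =
      (z.1 (idx x₀) • (affineLin (idx x₀)).toLinearMap ∘ₗ triv x₀ x) v + c • z.1 := by
  obtain ⟨z, hz, hzx⟩ := z
  set i := idx x with hi
  set j := idx x₀ with hj
  have hzi : z i ≠ 0 := (rep_mk_ne_zero i z hz).1 (by rw [hzx]; exact rep_idx_ne_zero x)
  have hzj : z j ≠ 0 := (rep_mk_ne_zero j z hz).1 (by rw [hzx]; exact hx)
  set w₀ : Fin N → ℂ := affineCoord j x with hw₀
  have hw₀' : z j • affineVec j w₀ = z := by
    rw [hw₀, ← hzx, affineCoord_mk]; exact smul_affineVec j z hzj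
  have hz0 : affineVec j w₀ = (z j)⁻¹ • z := by
    rw [eq_inv_smul_iff₀ hzj, hw₀']
  have hsi : affineVec j w₀ i = (z j)⁻¹ * z i := by rw [hz0]; rfl
  have hsi0 : affineVec j w₀ i ≠ 0 := by rw [hsi]; exact mul_ne_zero (inv_ne_zero hzj) hzi
  -- In the chart around x₀ the lift through z is the affine representative rescaled to have i-th
  -- coordinate z i. Differentiating the scale c contributes only a radial vector.
  let c : (Fin N → ℂ) → ℂ := fun w => z i * (affineVec j w i)⁻¹
  let g : (Fin N → ℂ) → Vec N := fun w => c w • affineVec j w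
  have hA := hasFDerivAt_affineVec j w₀
  have hAi : HasFDerivAt (fun w => affineVec j w i) _ w₀ := (hasFDerivAt_pi'.1 hA) i
  have hc : DifferentiableAt ℂ c w₀ :=
    (hAi.differentiableAt.fun_inv hsi0).const_mul (z i)
  have hg : HasFDerivAt g
      (c w₀ • affineLin j + (fderiv ℂ c w₀).smulRight (affineVec j w₀)) w₀ :=
    hc.hasFDerivAt.smul hA
  have hcw : c w₀ = z j := by
    change z i * (affineVec j w₀ i)⁻¹ = z j
    rw [hsi]; field_simp
  have hchart : MDifferentiableAt 𝓘(ℂ, Fin N → ℂ) 𝓘(ℂ, Fin N → ℂ)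
      (extChartAt 𝓘(ℂ, Fin N → ℂ) x₀) x := mdifferentiableAt_extChartAt hx
  have hev : liftThrough x z =ᶠ[nhds x] g ∘ extChartAt 𝓘(ℂ, Fin N → ℂ) x₀ := by
    filter_upwards [(chartAt (Fin N → ℂ) x₀).open_source.mem_nhds hx] with y hy
    induction y using Projectivization.ind with
    | h u hu =>
      have huj : u j ≠ 0 := (rep_mk_ne_zero j u hu).1 hy
      have h1 : extChartAt 𝓘(ℂ, Fin N → ℂ) x₀ (Projectivization.mk ℂ u hu) =
          fun a => u (j.succAbove a) / u j := affineCoord_mk j u hu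
      have h2 : affineVec j (fun a => u (j.succAbove a) / u j) = (u j)⁻¹ • u := by
        rw [eq_inv_smul_iff₀ huj, smul_affineVec j u huj]
      obtain ⟨a, ha, h3⟩ := rep_mk u hu
      simp only [Function.comp_apply, h1, g, c, h2, liftThrough, h3, smul_smul]
      rw [← hi]
      congr 1
      simp only [Pi.smul_apply, smul_eq_mul]
      by_cases hui : u i = 0
      · simp [hui]
      · field_simp
  have hmf := ((hg.hasMFDerivAt.comp x hchart.hasMFDerivAt).congr_of_eventuallyEq hev).mfderiv
  have htriv : mfderiv 𝓘(ℂ, Fin N → ℂ) 𝓘(ℂ, Fin N → ℂ)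
        (extChartAt 𝓘(ℂ, Fin N → ℂ) x₀) x v = triv x₀ x v :=
    (congrArg (fun f => f v) (TangentBundle.continuousLinearMapAt_trivializationAt hx)).symm
  have h4 : tangentLift ⟨z, hz, hzx⟩ v =
      (c w₀ • affineLin j + (fderiv ℂ c w₀).smulRight (affineVec j w₀)) (triv x₀ x v) := by
    rw [← htriv]
    exact congrArg (fun f => f v) hmf
  refine ⟨fderiv ℂ c w₀ (triv x₀ x v) * (z j)⁻¹, ?_⟩
  rw [h4]
  simp only [add_apply, smul_apply, ContinuousLinearMap.smulRight_apply, hcw, hz0, smul_smul]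
  rfl

theorem contactForm_eq {n : ℕ} {x : CP (2 * n + 1)} (z : Line x) :
    contactForm z = contactHom n z.1 ∘ₗ tangentLift z := rfl

/-! ### The differential of the projection from the cone -/

/-- The coordinates other than the `j`-th one. -/
def dropCoord (j : Fin (N + 1)) : Vec N →ₗ[ℂ] (Fin N → ℂ) :=
  LinearMap.funLeft ℂ ℂ j.succAbove

/-- The `j`-th coordinate function, normalized to take the value `1` at `z`. -/
def unitCoord (j : Fin (N + 1)) (z : Vec N) : Vec N →ₗ[ℂ] ℂ := (z j)⁻¹ • LinearMap.proj j

theorem unitCoord_self {j : Fin (N + 1)} {z : Vec N} (hz : z j ≠ 0) : unitCoord j z z = 1 := by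
  simp [unitCoord, hz]

/-- The differential at `z` of the projection to `ℂP^N`, in the `j`-th affine chart. -/
def chartDiff (j : Fin (N + 1)) (z : Vec N) : Vec N →ₗ[ℂ] (Fin N → ℂ) :=
  (z j)⁻¹ • dropCoord j ∘ₗ (LinearMap.id - (unitCoord j z).smulRight z)

theorem chartDiff_self {j : Fin (N + 1)} {z : Vec N} (hz : z j ≠ 0) : chartDiff j z z = 0 := by
  simp [chartDiff, unitCoord_self hz]

theorem affineLin_same (j : Fin (N + 1)) (w : Fin N → ℂ) : affineLin j w j = 0 := by
  simp [affineLin]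

theorem affineLin_succAbove (j : Fin (N + 1)) (w : Fin N → ℂ) (b : Fin N) :
    affineLin j w (j.succAbove b) = w b := by
  simp [affineLin]

theorem chartDiff_affineLin {j : Fin (N + 1)} {z : Vec N} (hz : z j ≠ 0) (w : Fin N → ℂ) :
    chartDiff j z (z j • affineLin j w) = w := by
  funext b
  simp [chartDiff, dropCoord, unitCoord, affineLin_same, affineLin_succAbove, hz,
    LinearMap.funLeft_apply]

/-- The affine lift inverts `chartDiff` up to the radial direction. -/
theorem affineLin_chartDiff {j : Fin (N + 1)} {z : Vec N} (hz : z j ≠ 0) (v : Vec N) :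
    z j • affineLin j (chartDiff j z v) = v - unitCoord j z v • z := by
  funext a
  refine Fin.succAboveCases j ?_ (fun b => ?_) a
  · simp only [Pi.smul_apply, affineLin_same, unitCoord, Pi.sub_apply, LinearMap.smul_apply,
      LinearMap.proj_apply, smul_eq_mul]
    field_simp
    simp
  · simp [chartDiff, dropCoord, affineLin_succAbove, hz, LinearMap.funLeft_apply]

theorem chartDiff_smul (j : Fin (N + 1)) {a : ℂ} (ha : a ≠ 0) (z : Vec N) :
    chartDiff j (a • z) = a⁻¹ • chartDiff j z := by
  have h : (unitCoord j (a • z)).smulRight (a • z) = (unitCoord j z).smulRight z := by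
    ext v b
    simp only [unitCoord, LinearMap.comp_apply, LinearMap.smulRight_apply, LinearMap.smul_apply,
      Pi.smul_apply, smul_eq_mul, mul_inv]
    field_simp
  rw [chartDiff, chartDiff, h, Pi.smul_apply, smul_eq_mul, mul_inv, smul_smul]

/-- Makes the dependence on z explicit, through powers of z_j⁻¹ and one product with z, so that
holomorphy can be read off. -/
theorem map_chartDiff {j : Fin (N + 1)} (z : Vec N) {q : ℕ} {X : ExteriorAlgebra ℂ (Vec N)}
    (hX : X ∈ ⋀[ℂ]^q (Vec N)) : ExteriorAlgebra.map (chartDiff j z) X =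
      ((z j)⁻¹ ^ q) • ExteriorAlgebra.map (dropCoord j)
        (X - (z j)⁻¹ • (ι ℂ z * contract (LinearMap.proj j) X)) := by
  rw [chartDiff, map_smul_apply _ _ hX, ← ExteriorAlgebra.map_comp_map, AlgHom.comp_apply,
    map_sub_smulRight, unitCoord, contract_smul, mul_smul_comm]

theorem WeakDiffAt.map_chartDiff {j : Fin (N + 1)} {z : Vec N} (hz : z j ≠ 0) {q : ℕ}
    {Y : Vec N → ExteriorAlgebra ℂ (Vec N)} (hY : WeakDiffAt Y z)
    (hq : ∀ᶠ y in nhds z, Y y ∈ ⋀[ℂ]^q (Vec N)) :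
    WeakDiffAt (fun y => ExteriorAlgebra.map (chartDiff j y) (Y y)) z := by
  have hinv : DifferentiableAt ℂ (fun z : Vec N => (z j)⁻¹) z :=
    (differentiableAt_apply j z).fun_inv hz
  have h0 : WeakDiffAt (fun y => contract (LinearMap.proj j) (Y y)) z := hY.linear _
  have h1 : WeakDiffAt (fun y => (y j)⁻¹ • wedge y (contract (LinearMap.proj j) (Y y))) z :=
    WeakDiffAt.smul hinv (h0.bilin wedge)
  have h2 := (hY.sub h1).linear (ExteriorAlgebra.map (dropCoord j)).toLinearMap
  refine (WeakDiffAt.smul (hinv.fun_pow q) h2).congr ?_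
  filter_upwards [hq] with y hy
  exact ContactCP.map_chartDiff y hy

theorem Line.apply_ne_zero {x : CP N} (z : Line x) {x₀ : CP N}
    (hx : x ∈ (chartAt (Fin N → ℂ) x₀).source) : z.1 (idx x₀) ≠ 0 := by
  obtain ⟨z, hz, rfl⟩ := z
  exact (rep_mk_ne_zero _ z hz).1 hx

/-- The differential at `z` of the projection to `ℂP^N`. -/
def projDiff {x : CP N} (z : Line x) : Vec N →ₗ[ℂ] T x :=
  ((trivializationAt (Fin N → ℂ) (TangentSpace 𝓘(ℂ, Fin N → ℂ)) x).symmL ℂ x :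
    (Fin N → ℂ) →L[ℂ] T x).toLinearMap ∘ₗ chartDiff (idx x) z.1

theorem triv_projDiff_self {x : CP N} (z : Line x) (v : Vec N) :
    triv x x (projDiff z v) = chartDiff (idx x) z.1 v :=
  Bundle.Trivialization.continuousLinearMapAt_symmL _
    (FiberBundle.mem_baseSet_trivializationAt' x) _

theorem projDiff_self {x : CP N} (z : Line x) : projDiff z z.1 = 0 := by
  rw [projDiff, LinearMap.comp_apply, chartDiff_self (z.apply_ne_zero (mem_chart_source _ x)),
    map_zero]

theorem projDiff_smul {x : CP N} {z z' : Line x} {a : ℂ} (h : z'.1 = a • z.1) :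
    projDiff z' = a⁻¹ • projDiff z := by
  have ha : a ≠ 0 := fun h0 => z'.2.1 (by rw [h, h0, zero_smul])
  rw [projDiff, projDiff, h, chartDiff_smul _ ha, LinearMap.comp_smul]

theorem chartDiff_tangentLift {x : CP N} (z : Line x) {x₀ : CP N}
    (hx : x ∈ (chartAt (Fin N → ℂ) x₀).source) (v : T x) :
    chartDiff (idx x₀) z.1 (tangentLift z v) = triv x₀ x v := by
  obtain ⟨c, hc⟩ := tangentLift_apply z x₀ hx v
  rw [hc, map_add, map_smul, chartDiff_self (z.apply_ne_zero hx), smul_zero, add_zero]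
  exact chartDiff_affineLin (z.apply_ne_zero hx) _

theorem projDiff_tangentLift {x : CP N} (z : Line x) (v : T x) :
    projDiff z (tangentLift z v) = v := by
  rw [projDiff, LinearMap.comp_apply, chartDiff_tangentLift z (mem_chart_source _ x)]
  exact Bundle.Trivialization.symmL_continuousLinearMapAt _
    (FiberBundle.mem_baseSet_trivializationAt' x) _

theorem tangentLift_projDiff {x : CP N} (z : Line x) (v : Vec N) :
    ∃ c : ℂ, tangentLift z (projDiff z v) = v + c • z.1 := by
  obtain ⟨c, hc⟩ := tangentLift_apply z x (mem_chart_source _ x) (projDiff z v)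
  refine ⟨c - unitCoord (idx x) z.1 v, ?_⟩
  rw [hc, LinearMap.smul_apply, LinearMap.comp_apply, triv_projDiff_self]
  rw [ContinuousLinearMap.coe_coe, affineLin_chartDiff (z.apply_ne_zero (mem_chart_source _ x))]
  module

/-- `projDiff` is defined by the chart at x; comparison with the chart-free `tangentLift` shows that
it has the expected form in every chart. -/
theorem triv_projDiff {x : CP N} (z : Line x) {x₀ : CP N}
    (hx : x ∈ (chartAt (Fin N → ℂ) x₀).source) :
    triv x₀ x ∘ₗ projDiff z = chartDiff (idx x₀) z.1 := LinearMap.ext fun v => by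
  obtain ⟨c, hc⟩ := tangentLift_projDiff z v
  rw [LinearMap.comp_apply, ← chartDiff_tangentLift z hx, hc, map_add, map_smul,
    chartDiff_self (z.apply_ne_zero hx), smul_zero, add_zero]

/-- The radial ambiguity of the lift is invisible because ω(z, z) = 0. -/
theorem contactForm_projDiff {n : ℕ} {x : CP (2 * n + 1)} (z : Line x) :
    contactForm z ∘ₗ projDiff z = contactHom n z.1 := LinearMap.ext fun v => by
  obtain ⟨c, hc⟩ := tangentLift_projDiff z v
  rw [contactForm_eq, LinearMap.comp_apply, LinearMap.comp_apply, hc, map_add, map_smul,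
    contactHom_self, smul_zero, add_zero]

theorem map_projDiff_congr {x : CP N} (z : Line x) {X Y : ExteriorAlgebra ℂ (Vec N)}
    (h : ι ℂ z.1 * X = ι ℂ z.1 * Y) :
    ExteriorAlgebra.map (projDiff z) X = ExteriorAlgebra.map (projDiff z) Y := by
  rw [← sub_eq_zero, ← map_sub]
  exact map_eq_zero_of_ι_mul (unitCoord_self (z.apply_ne_zero (mem_chart_source _ x))) _
    (projDiff_self z) (by rw [mul_sub, h, sub_self])

/-! ### Lifts of sections -/

theorem isOpenCone_cone {S : Set (CP N)} (hS : IsOpen S) : IsOpenCone (cone S) where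
  isOpen := isOpen_cone hS
  smul_mem z hz a ha := by
    obtain ⟨h, hz⟩ := hz
    have h' : a • z ≠ 0 := smul_ne_zero ha h
    refine ⟨h', ?_⟩
    rwa [(Projectivization.mk_eq_mk_iff' ℂ (a • z) z h' h).2 ⟨a, rfl⟩]
  ne_zero z hz := hz.1

theorem localRep_line {U : Opens (CP N)} (σ : ∀ x : U, Line x.1 → ExtT x.1) (x₀ : CP N) {x : CP N}
    (hx : x ∈ U) (z : Line x) :
    localRep σ x₀ z.1 = ExteriorAlgebra.map (triv x₀ x) (σ ⟨x, hx⟩ z) := by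
  obtain ⟨z, hz, rfl⟩ := z
  rw [localRep, dif_pos (show z ∈ cone (U : Set (CP N)) from ⟨hz, hx⟩)]

/-- The polyvector field on the cone over a chart which is given by a section. -/
def liftField {U : Opens (CP N)} (q : ℕ) (σ : ∀ x : U, Line x.1 → ExtT x.1) (x₀ : CP N)
    (z : Vec N) : ExteriorAlgebra ℂ (Vec N) :=
  -- The power of z_j turns the map induced by `affineLin` into the one induced by the differential
  -- of the lift through z, modulo z. It also raises the homogeneity from m to m + q.
  z (idx x₀) ^ q • ExteriorAlgebra.map (affineLin (idx x₀)).toLinearMap (localRep σ x₀ z)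

theorem liftField_line {U : Opens (CP N)} {q : ℕ} {σ : ∀ x : U, Line x.1 → ExtT x.1} (x₀ : CP N)
    {x : CP N} (hx : x ∈ U) (z : Line x) (hσ : σ ⟨x, hx⟩ z ∈ ⋀[ℂ]^q (T x)) :
    liftField q σ x₀ z.1 = ExteriorAlgebra.map
      (z.1 (idx x₀) • (affineLin (idx x₀)).toLinearMap ∘ₗ triv x₀ x) (σ ⟨x, hx⟩ z) := by
  rw [liftField, localRep_line σ x₀ hx, map_smul_apply _ _ hσ, ← ExteriorAlgebra.map_comp_map]
  rfl

/-- The right side does not involve x₀: modulo z, the lift is independent of the chart. -/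
theorem ι_mul_liftField {U : Opens (CP N)} {q : ℕ} {σ : ∀ x : U, Line x.1 → ExtT x.1} {x₀ : CP N}
    {x : CP N} (hx : x ∈ U) (hx₀ : x ∈ (chartAt (Fin N → ℂ) x₀).source) (z : Line x)
    (hσ : σ ⟨x, hx⟩ z ∈ ⋀[ℂ]^q (T x)) : ι ℂ z.1 * liftField q σ x₀ z.1 =
      ι ℂ z.1 * ExteriorAlgebra.map (tangentLift z) (σ ⟨x, hx⟩ z) := by
  rw [liftField_line x₀ hx z hσ]
  exact (ι_mul_map_congr _ _ _ (tangentLift_apply z x₀ hx₀) _).symm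

/-- The lift pulls ω(z, ·) back to the contact form, which vanishes on D. -/
theorem contract_liftField {n : ℕ} {U : Opens (CP (2 * n + 1))} {q : ℕ}
    {σ : ∀ x : U, Line x.1 → ExtT x.1} {x₀ : CP (2 * n + 1)} {x : CP (2 * n + 1)} (hx : x ∈ U)
    (hx₀ : x ∈ (chartAt (Fin (2 * n + 1) → ℂ) x₀).source) (z : Line x)
    (hσ : σ ⟨x, hx⟩ z ∈ extPow q (contactDist x)) :
    contract (contactHom n z.1) (liftField q σ x₀ z.1) = 0 := by
  rw [liftField_line x₀ hx z (extPow_le _ _ hσ), contract_map]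
  have h : contactHom n z.1 ∘ₗ (z.1 (idx x₀) • (affineLin (idx x₀)).toLinearMap ∘ₗ triv x₀ x) =
      contactForm z := LinearMap.ext fun v => by
    rw [contactForm_apply z x₀ hx₀]
    simp
  rw [h]
  rw [← ker_contactForm z] at hσ
  rw [contract_extPow _ _ hσ, map_zero]

theorem isPolyField_liftField {U : Opens (CP N)} {q : ℕ} {m : ℤ}
    {F : ∀ x : CP N, Submodule ℂ (ExtT x)} (hF : ∀ x, F x ≤ ⋀[ℂ]^q (T x))
    {σ : ∀ x : U, Fiber m (F x.1)} (hσ : σ ∈ sections m F U) (x₀ : CP N) :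
    IsPolyField (cone ((U : Set (CP N)) ∩ (chartAt (Fin N → ℂ) x₀).source)) (m + q) q
      (liftField q (fun x => (σ x).1) x₀) where
  weakDiffAt z hz := by
    refine WeakDiffAt.smul ((differentiableAt_apply _ z).fun_pow q) fun φ => ?_
    exact (hσ x₀ (φ ∘ₗ (ExteriorAlgebra.map (affineLin (idx x₀)).toLinearMap).toLinearMap)
      ).differentiableAt ((isOpen_cone (U.2.inter (chartAt (Fin N → ℂ) x₀).open_source)).mem_nhds hz)
  smul z hz a ha := by
    obtain ⟨hz, hzU, hz₀⟩ := hz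
    let z₁ : Line (Projectivization.mk ℂ z hz) := ⟨z, hz, rfl⟩
    have hz' : a • z ≠ 0 := smul_ne_zero ha hz
    let z₂ : Line (Projectivization.mk ℂ z hz) :=
      ⟨a • z, hz', (Projectivization.mk_eq_mk_iff' ℂ (a • z) z hz' hz).2 ⟨a, rfl⟩⟩
    have h1 := localRep_line (fun x => (σ x).1) x₀ hzU z₁
    have h2 := localRep_line (fun x => (σ x).1) x₀ hzU z₂
    rw [(σ ⟨_, hzU⟩).2.2 z₁ z₂ a rfl, map_smul, ← h1] at h2
    change localRep (fun x => (σ x).1) x₀ (a • z) = a ^ m • localRep (fun x => (σ x).1) x₀ z at h2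
    rw [liftField, liftField, h2, map_smul, Pi.smul_apply, smul_eq_mul, mul_pow, smul_smul,
      smul_smul, zpow_add₀ ha, zpow_natCast]
    congr 1
    ring
  mem z hz := by
    obtain ⟨hz, hzU, hz₀⟩ := hz
    have h := liftField_line (σ := fun x => (σ x).1) x₀ hzU ⟨z, hz, rfl⟩
      (hF _ ((σ ⟨_, hzU⟩).2.1 ⟨z, hz, rfl⟩))
    change liftField q (fun x => (σ x).1) x₀ z = _ at h
    rw [h]
    exact map_mem_pow _ _ (hF _ ((σ ⟨_, hzU⟩).2.1 _))

end

end

end ContactCP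

namespace ContactCP

noncomputable section

open ExteriorAlgebra (ι)
open SymplecticForm (IsRegular)

variable {n q : ℕ} {m : ℤ}

/-! ### The splitting -/

/-- The value at a point of the splitting operator. -/
def splitValue (m : ℤ) (q : ℕ) {U : Opens (CP (2 * n + 1))} (σ : ∀ x : U, Line x.1 → ExtT x.1)
    (x : U) (z : Line x.1) : ExtT x.1 :=
  ExteriorAlgebra.map (projDiff z)
    ((contactSymplectic n).splitOp (m + 2 + q) q (liftField q σ x.1) z.1)

section

variable {U : Opens (CP (2 * n + 1))}
  {σ τ : ∀ x : U, Fiber (m + 2) (extPow q (contactDist x.1))}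

theorem Line.mem_cone {x : CP (2 * n + 1)} (z : Line x) {S : Set (CP (2 * n + 1))} (hx : x ∈ S) :
    z.1 ∈ cone S := by
  obtain ⟨z, hz, rfl⟩ := z
  exact ⟨hz, hx⟩

theorem isPolyField_liftField_extPow (hσ : σ ∈ sections (m + 2) (fun x => extPow q (contactDist x)) U)
    (x₀ : CP (2 * n + 1)) :
    IsPolyField (cone ((U : Set _) ∩ (chartAt (Fin (2 * n + 1) → ℂ) x₀).source)) (m + 2 + q) q
      (liftField q (fun x => (σ x).1) x₀) :=
  isPolyField_liftField (fun x => extPow_le q (contactDist x)) hσ x₀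

theorem weakDiffAt_liftField (hσ : σ ∈ sections (m + 2) (fun x => extPow q (contactDist x)) U)
    (x : U) (z : Line x.1) : WeakDiffAt (liftField q (fun x => (σ x).1) x.1) z.1 :=
  (isPolyField_liftField_extPow hσ x.1).1 _ (z.mem_cone ⟨x.2, mem_chart_source _ x.1⟩)

/-- The splitting operator does not depend on the chart. -/
theorem splitValue_eq (hr : IsRegular (2 * n + 1 + 1) (m + 2 + q) q)
    (hσ : σ ∈ sections (m + 2) (fun x => extPow q (contactDist x)) U) (x : U) (z : Line x.1)
    {x₀ : CP (2 * n + 1)} (hx₀ : x.1 ∈ (chartAt (Fin (2 * n + 1) → ℂ) x₀).source) :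
    splitValue m q (fun x => (σ x).1) x z = ExteriorAlgebra.map (projDiff z)
      ((contactSymplectic n).splitOp (m + 2 + q) q (liftField q (fun x => (σ x).1) x₀) z.1) := by
  set s₀ := (chartAt (Fin (2 * n + 1) → ℂ) x₀).source
  set s := (chartAt (Fin (2 * n + 1) → ℂ) x.1).source
  set C := cone ((U : Set _) ∩ (s ∩ s₀)) with hC
  have hCo : IsOpenCone C := isOpenCone_cone (U.2.inter ((chartAt _ x.1).open_source.inter
    (chartAt _ x₀).open_source))
  have hz : z.1 ∈ C := z.mem_cone ⟨x.2, mem_chart_source _ x.1, hx₀⟩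
  have hP := (isPolyField_liftField_extPow hσ x.1).mono
    (show C ⊆ cone ((U : Set _) ∩ s) from fun _ hy => ⟨hy.1, hy.2.1, hy.2.2.1⟩)
  have hP₀ := (isPolyField_liftField_extPow hσ x₀).mono
    (show C ⊆ cone ((U : Set _) ∩ s₀) from fun _ hy => ⟨hy.1, hy.2.1, hy.2.2.2⟩)
  -- The difference of the two lifts is killed by z and by contraction with ω(z, ·), so
  -- `ι_mul_splitOp` applies to it.
  have hR := hP.sub hP₀
  have key := (contactSymplectic n).ι_mul_splitOp hCo hr hR (fun y hy => by
      obtain ⟨hy, hyU, hys, hys₀⟩ := hy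
      have h1 := contract_liftField (σ := fun x => (σ x).1) (q := q) hyU hys ⟨y, hy, rfl⟩
        ((σ ⟨_, hyU⟩).2.1 _)
      have h2 := contract_liftField (σ := fun x => (σ x).1) (q := q) hyU hys₀ ⟨y, hy, rfl⟩
        ((σ ⟨_, hyU⟩).2.1 _)
      rw [contactSymplectic_form, map_sub]
      exact (congrArg₂ _ h1 h2).trans (sub_zero 0)) (fun y hy => by
      obtain ⟨hy, hyU, hys, hys₀⟩ := hy
      have h1 := ι_mul_liftField (σ := fun x => (σ x).1) (q := q) hyU hys ⟨y, hy, rfl⟩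
        (extPow_le _ _ ((σ ⟨_, hyU⟩).2.1 _))
      have h2 := ι_mul_liftField (σ := fun x => (σ x).1) (q := q) hyU hys₀ ⟨y, hy, rfl⟩
        (extPow_le _ _ ((σ ⟨_, hyU⟩).2.1 _))
      rw [mul_sub, sub_eq_zero]
      exact h1.trans h2.symm) hz
  refine map_projDiff_congr z ?_
  have h := (contactSymplectic n).splitOp_add (d := m + 2 + q) (q := q) (hR.1 _ hz) (hP₀.1 _ hz)
  simp only [sub_add_cancel] at h
  rw [h, mul_add, key, zero_add]

theorem splitValue_mem
    (hσ : σ ∈ sections (m + 2) (fun x => extPow q (contactDist x)) U) (x : U) :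
    splitValue m q (fun x => (σ x).1) x ∈ Fiber m (⋀[ℂ]^(q + 1) (T x.1)) := by
  have hP := (contactSymplectic n).isPolyField_splitOp (isOpenCone_cone (U.2.inter
    (chartAt (Fin (2 * n + 1) → ℂ) x.1).open_source)) (isPolyField_liftField_extPow hσ x.1)
  have hz : ∀ z : Line x.1, z.1 ∈ cone ((U : Set _) ∩
    (chartAt (Fin (2 * n + 1) → ℂ) x.1).source) := fun z =>
      z.mem_cone ⟨x.2, mem_chart_source _ x.1⟩
  refine ⟨fun z => map_mem_pow _ _ (hP.3 _ (hz z)), fun z z' a h => ?_⟩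
  have ha : a ≠ 0 := fun h0 => z'.2.1 (by rw [h, h0, zero_smul])
  rw [splitValue, splitValue, projDiff_smul h, map_smul_apply _ _ (hP.3 _ (hz z')), h,
    hP.2 _ (hz z) a ha, map_smul, smul_smul]
  congr 1
  -- Degree count: the operator gives degree m + q + 1, and projecting q + 1 vector factors lowers
  -- it to m.
  rw [inv_pow, ← zpow_natCast a, ← zpow_neg, ← zpow_add₀ ha]
  congr 1
  push_cast
  ring

/-- The chart used in `splitValue` varies with the point. By `splitValue_eq` one fixed chart x₀ may
be used instead, and then everything is visibly holomorphic. -/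
theorem isHolomorphic_splitValue (hr : IsRegular (2 * n + 1 + 1) (m + 2 + q) q)
    (hσ : σ ∈ sections (m + 2) (fun x => extPow q (contactDist x)) U) :
    IsHolomorphic (splitValue m q fun x => (σ x).1) := by
  intro x₀ φ
  set j := idx x₀
  set C := cone ((U : Set _) ∩ (chartAt (Fin (2 * n + 1) → ℂ) x₀).source)
  let Y := (contactSymplectic n).splitOp (m + 2 + q) q (liftField q (fun x => (σ x).1) x₀)
  have hP : IsPolyField C _ _ Y := (contactSymplectic n).isPolyField_splitOp (isOpenCone_cone
    (U.2.inter (chartAt (Fin (2 * n + 1) → ℂ) x₀).open_source)) (isPolyField_liftField_extPow hσ x₀)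
  have hCo : IsOpen C := isOpen_cone (U.2.inter (chartAt (Fin (2 * n + 1) → ℂ) x₀).open_source)
  have hd : DifferentiableOn ℂ
      (fun z : Vec (2 * n + 1) => φ (ExteriorAlgebra.map (chartDiff j z) (Y z))) C := fun z hz =>
    (WeakDiffAt.map_chartDiff (Line.apply_ne_zero ⟨z, hz.1, rfl⟩ hz.2.2) (hP.1 z hz)
      (by filter_upwards [hCo.mem_nhds hz] with y hy using hP.3 y hy) φ).differentiableWithinAt
  refine hd.congr fun z hz => ?_
  obtain ⟨hz0, hzU, hz₀⟩ := hz
  have h := localRep_line (splitValue m q fun x => (σ x).1) x₀ hzU ⟨z, hz0, rfl⟩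
  change localRep _ x₀ z = _ at h
  rw [h, splitValue_eq hr hσ ⟨_, hzU⟩ ⟨z, hz0, rfl⟩ hz₀, ← AlgHom.comp_apply, ExteriorAlgebra.map_comp_map]
  rw [triv_projDiff ⟨z, hz0, rfl⟩ hz₀]

/-- The identity modulo z on the cone becomes exact after projection, and projecting the tangent
lift returns the original section. -/
theorem contract_splitValue (hr : IsRegular (2 * n + 1 + 1) (m + 2 + q) q)
    (hσ : σ ∈ sections (m + 2) (fun x => extPow q (contactDist x)) U) (x : U) (z : Line x.1) :
    contract (contactForm z) (splitValue m q (fun x => (σ x).1) x z) = (σ x).1 z := by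
  have hx := mem_chart_source (Fin (2 * n + 1) → ℂ) x.1
  have key := (contactSymplectic n).ι_mul_contract_splitOp (isOpenCone_cone (U.2.inter
    (chartAt (Fin (2 * n + 1) → ℂ) x.1).open_source)) hr (isPolyField_liftField_extPow hσ x.1)
    (fun y hy => by
      obtain ⟨hy, hyU, hys⟩ := hy
      exact contract_liftField (σ := fun x => (σ x).1) (q := q) hyU hys ⟨y, hy, rfl⟩
        ((σ ⟨_, hyU⟩).2.1 _)) (z.mem_cone ⟨x.2, hx⟩)
  rw [splitValue, contract_map, contactForm_projDiff, ← contactSymplectic_form,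
    map_projDiff_congr z (key.trans (ι_mul_liftField (σ := fun x => (σ x).1) x.2 hx z
      (extPow_le _ _ ((σ x).2.1 z)))), ← AlgHom.comp_apply, ExteriorAlgebra.map_comp_map]
  have : projDiff z ∘ₗ tangentLift z = LinearMap.id := LinearMap.ext (projDiff_tangentLift z)
  rw [this, ExteriorAlgebra.map_id]
  rfl

theorem splitValue_add (hσ : σ ∈ sections (m + 2) (fun x => extPow q (contactDist x)) U)
    (hτ : τ ∈ sections (m + 2) (fun x => extPow q (contactDist x)) U) (x : U) (z : Line x.1) :
    splitValue m q (fun x => (σ x).1 + (τ x).1) x z =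
      splitValue m q (fun x => (σ x).1) x z + splitValue m q (fun x => (τ x).1) x z := by
  have h : liftField q (fun x => (σ x).1 + (τ x).1) x.1 = fun y =>
      liftField q (fun x => (σ x).1) x.1 y + liftField q (fun x => (τ x).1) x.1 y := by
    funext y
    simp only [liftField, localRep]
    split_ifs <;> simp
  rw [splitValue, h, SymplecticForm.splitOp_add _ (weakDiffAt_liftField hσ x z)
    (weakDiffAt_liftField hτ x z), map_add]
  rfl

theorem splitValue_smul (c : ℂ)
    (hσ : σ ∈ sections (m + 2) (fun x => extPow q (contactDist x)) U) (x : U) (z : Line x.1) :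
    splitValue m q (fun x => c • (σ x).1) x z = c • splitValue m q (fun x => (σ x).1) x z := by
  have h : liftField q (fun x => c • (σ x).1) x.1 = fun y =>
      c • liftField q (fun x => (σ x).1) x.1 y := by
    funext y
    simp only [liftField, localRep]
    split_ifs <;> simp [smul_comm c]
  rw [splitValue, h, SymplecticForm.splitOp_const_smul _ c (weakDiffAt_liftField hσ x z), map_smul]
  rfl

end

theorem splitValue_restrict {U V : Opens (CP (2 * n + 1))} (i : V ≤ U)
    (σ : ∀ x : U, Line x.1 → ExtT x.1) (x : V) (z : Line x.1) :
    splitValue m q (fun x : V => σ ⟨x.1, i x.2⟩) x z = splitValue m q σ ⟨x.1, i x.2⟩ z := by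
  have h : liftField q (fun x : V => σ ⟨x.1, i x.2⟩) x.1 =ᶠ[nhds z.1] liftField q σ x.1 := by
    filter_upwards [(isOpen_cone V.2).mem_nhds (z.mem_cone x.2)] with y hy
    rw [liftField, liftField, localRep_restrict i σ x.1 y hy]
  rw [splitValue, SymplecticForm.splitOp_congr _ h]
  rfl

/-- The splitting of `γ` by a differential operator. -/
def splitMap (hr : IsRegular (2 * n + 1 + 1) (m + 2 + q) q) :
    sheafD n q (m + 2) ⟶ sheafT n (q + 1) m :=
  ⟨{ app := fun _ => ModuleCat.ofHom
      { toFun := fun σ => ⟨fun x => ⟨splitValue m q (fun x => (σ.1 x).1) x,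
          splitValue_mem σ.2 x⟩, isHolomorphic_splitValue hr σ.2⟩
        map_add' := fun σ τ => Subtype.ext (funext fun x => Subtype.ext (funext fun z =>
          splitValue_add σ.2 τ.2 x z))
        map_smul' := fun c σ => Subtype.ext (funext fun x => Subtype.ext (funext fun z =>
          splitValue_smul c σ.2 x z)) }
     naturality := fun U V i => by
      ext σ
      exact Subtype.ext (funext fun x => Subtype.ext (funext fun z =>
        splitValue_restrict i.unop.le (fun x => (σ.1 x).1) x z)) }⟩

theorem splitMap_gammaMap (hr : IsRegular (2 * n + 1 + 1) (m + 2 + q) q) :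
    splitMap hr ≫ gammaMap n (q + 1) m = 𝟙 (sheafD n q (m + 2)) := by
  refine Sheaf.hom_ext (NatTrans.ext (funext fun U => ModuleCat.hom_ext (LinearMap.ext fun σ => ?_)))
  exact Subtype.ext (funext fun x => Subtype.ext (funext fun z => contract_splitValue hr σ.2 x z))

/-! ### The kernel of γ and the splitting of the sequence -/

theorem exists_contactForm_eq_one {x : CP (2 * n + 1)} (z : Line x) : ∃ e, contactForm z e = 1 := by
  obtain ⟨i, hi⟩ := Function.ne_iff.1 z.2.1
  refine ⟨projDiff z ((z.1 i)⁻¹ • (contactSymplectic n).dual i), ?_⟩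
  rw [← LinearMap.comp_apply, contactForm_projDiff, ← contactSymplectic_form, map_smul,
    SymplecticForm.form_dual]
  exact inv_mul_cancel₀ hi

/-- If γ(e) = 1 and X is killed by the contraction, then X is the contraction of e ∧ X, and
contractions always take values in the exterior algebra of the kernel. -/
theorem mem_extPow_of_contract_eq_zero {k : ℕ} {x : CP (2 * n + 1)} (z : Line x) {X : ExtT x}
    (hX : X ∈ ⋀[ℂ]^k (T x)) (h : contract (contactForm z) X = 0) :
    X ∈ extPow k (contactDist x) := by
  obtain ⟨e, he⟩ := exists_contactForm_eq_one z
  have h1 := contract_mem_extPow (contactForm z) (k + 1) (ι_mul_mem e hX)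
  rw [contract_ι_mul, he, one_smul, h, mul_zero, sub_zero, ker_contactForm] at h1
  exact h1

/-- Sections of `l^m ⊗ ⋀^k T` which are killed by `γ` are sections of `l^m ⊗ ⋀^k D`. -/
def liftToKer {k : ℕ} {F : TopCat.Sheaf (ModuleCat.{0} ℂ) (TopCat.of (CP (2 * n + 1)))}
    (f : F ⟶ sheafT n k m) (hf : f ≫ gammaMap n k m = 0) : F ⟶ sheafD n k m :=
  ⟨{ app := fun U => ModuleCat.ofHom
      { toFun := fun s => ⟨fun x => ⟨((f.hom.app U s).1 x).1, fun z =>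
            mem_extPow_of_contract_eq_zero z (((f.hom.app U s).1 x).2.1 z) (by
              have h := congrArg (fun g => (g.hom.app U s)) hf
              exact congrFun (congrArg Subtype.val (congrFun (congrArg Subtype.val h) x)) z),
            ((f.hom.app U s).1 x).2.2⟩, (f.hom.app U s).2⟩
        map_add' := fun s t => by
          refine Subtype.ext (funext fun x => Subtype.ext (funext fun z => ?_))
          exact congrFun (congrArg Subtype.val (congrFun (congrArg Subtype.val
            (map_add (f.hom.app U).hom s t)) x)) z
        map_smul' := fun c s => by
          refine Subtype.ext (funext fun x => Subtype.ext (funext fun z => ?_))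
          exact congrFun (congrArg Subtype.val (congrFun (congrArg Subtype.val
            (map_smul (f.hom.app U).hom c s)) x)) z }
     naturality := fun U V i => by
      ext s
      refine Subtype.ext (funext fun x => Subtype.ext (funext fun z => ?_))
      have h := congrArg (fun g => g.hom s) (f.hom.naturality i)
      exact congrFun (congrArg Subtype.val (congrFun (congrArg Subtype.val h) x)) z }⟩

theorem liftToKer_inclusion {k : ℕ}
    {F : TopCat.Sheaf (ModuleCat.{0} ℂ) (TopCat.of (CP (2 * n + 1)))}
    (f : F ⟶ sheafT n k m) (hf : f ≫ gammaMap n k m = 0) :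
    liftToKer f hf ≫ inclusion n k m = f := by
  refine Sheaf.hom_ext (NatTrans.ext (funext fun U => ModuleCat.hom_ext (LinearMap.ext fun s => ?_)))
  rfl

theorem inclusion_cancel {k : ℕ}
    {F : TopCat.Sheaf (ModuleCat.{0} ℂ) (TopCat.of (CP (2 * n + 1)))}
    {f g : F ⟶ sheafD n k m} (h : f ≫ inclusion n k m = g ≫ inclusion n k m) : f = g := by
  refine Sheaf.hom_ext (NatTrans.ext (funext fun U => ModuleCat.hom_ext (LinearMap.ext fun s => ?_)))
  refine Subtype.ext (funext fun x => Subtype.ext ?_)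
  have h := congrArg (fun g => (g.hom.app U s)) h
  have h' := congrArg Subtype.val (congrFun (congrArg Subtype.val h) x)
  exact h'

/-- The splitting of the sequence of sheaves. -/
def contactSplitting (hr : IsRegular (2 * n + 1 + 1) (m + 2 + q) q) :
    (contactSeq n (q + 1) m).Splitting :=
  let i : sheafD n (q + 1) m ⟶ sheafT n (q + 1) m := inclusion n (q + 1) m
  let g : sheafT n (q + 1) m ⟶ sheafD n q (m + 2) := gammaMap n (q + 1) m
  have h0 : i ≫ g = 0 := (contactSeq n (q + 1) m).zero
  have hs : splitMap hr ≫ g = 𝟙 (sheafD n q (m + 2)) := splitMap_gammaMap hr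
  -- The retraction is the projection id - s γ, which γ kills and which therefore factors through
  -- the kernel.
  have hr0 : (𝟙 (sheafT n (q + 1) m) - g ≫ splitMap hr) ≫ g = 0 := by
    rw [Preadditive.sub_comp, Category.assoc, hs, Category.id_comp, Category.comp_id, sub_self]
  let r : sheafT n (q + 1) m ⟶ sheafD n (q + 1) m := liftToKer _ hr0
  have hr1 : r ≫ i = 𝟙 (sheafT n (q + 1) m) - g ≫ splitMap hr := liftToKer_inclusion _ hr0
  have h1 : i ≫ r = 𝟙 (sheafD n (q + 1) m) := inclusion_cancel <| by
    change (i ≫ r) ≫ i = 𝟙 (sheafD n (q + 1) m) ≫ i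
    rw [Category.assoc, hr1, Preadditive.comp_sub, ← Category.assoc, h0, Limits.zero_comp,
      sub_zero, Category.comp_id, Category.id_comp]
  have h2 : r ≫ i + g ≫ splitMap hr = 𝟙 (sheafT n (q + 1) m) := by rw [hr1, sub_add_cancel]
  { r := r
    s := splitMap hr
    f_r := h1
    s_g := hs
    id := h2 }

end

end ContactCP

theorem theorem3p3 (n k : ℕ) (m : ℤ) (hk1 : 1 ≤ k) (hk2 : k ≤ 2 * n + 1)
    (hm : (Even m ∧ m ≤ -2 * (n : ℤ) - 2 * ((k / 2 : ℕ) : ℤ) - 4) ∨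
      (Even m ∧ -2 * (n : ℤ) - 2 ≤ m ∧ m ≤ -2 * (k : ℤ) - 2 ∧ k ≤ n) ∨
      (Even m ∧ -2 * ((k / 2 : ℕ) : ℤ) ≤ m) ∨
      (Odd m ∧ m ≤ -2 * (n : ℤ) - 2 * ((k / 2 : ℕ) : ℤ) - 3) ∨
      (Odd m ∧ -2 * (n : ℤ) - 3 ≤ m)) :
    Nonempty (ContactCP.contactSeq n k m).Splitting ∧
      ∀ i : ℕ, i ≤ 2 * n + 1 →
        ((ContactCP.contactSeq n k m).map (ContactCP.cohomology n i)).ShortExact := by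
  obtain ⟨q, rfl⟩ : ∃ q, k = q + 1 := ⟨k - 1, by omega⟩
  -- The denominators are m + 2k - 2j with 2j ≤ k - 1 and m + 2n + 4 + 2j with 2j ≤ k - 2. They have
  -- the parity of m, so only even m can be excluded: those with -2k ≤ m ≤ -2[k/2] - 2 or -2n -
  -- 2[k/2] - 2 ≤ m ≤ -2n - 4. The first three conditions avoid both ranges.
  have hr : ContactCP.SymplecticForm.IsRegular (2 * n + 1 + 1) (m + 2 + q) q := by
    simp only [Int.even_iff, Int.odd_iff] at hm
    constructor <;> intro j hj <;> push_cast <;> omega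
  have s := ContactCP.contactSplitting hr
  -- Cohomology is additive, so it carries the splitting to a splitting.
  exact ⟨⟨s⟩, fun i _ => (s.map (ContactCP.cohomology n i)).shortExact⟩
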